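/- **Setting.** Let $\mathcal X$ and $\Omega$ be compact metric spaces (for instance $\mathcal X\subset\mathbb R$ compact), $\mathcal A$ and $\mathcal H$ finite sets, and $\mathcal Z_t=(\mathcal X\times\mathcal A)^{t-1}\times\mathcal X$ the space of trajectories $z=(x_1,a_1,\dots,a_{t-1},x_t)$, $t\ge 1$. A parameter $\omega\in\Omega$ is drawn from a Borel probability measure (the prior). Under $\omega$, the first observation has law $\rho_\omega$ and, after the trajectory $z\in\mathcal Z_t$ and the query $a\in\mathcal A$, the next observation has law $P^\omega_t(\cdot\mid z,a)$; the maps $\omega\mapsto\rho_\omega$ and $(\omega,z,a)\mapsto P^\omega_t(\cdot\mid z,a)$ are weakly continuous, and $\rho_\omega\ll\nu_0$, $P_t^\omega(\cdot\mid z,a)\ll\nu$ for two fixed probability measures $\nu_0,\nu$, with jointly measurable densities $p_0^\omega(x)$, $p_t^\omega(x\mid z,a)$. The true hypothesis $H^\star\in\mathcal H$ is a measurable function of $\omega$. A policy $\pi=(\pi_t)_{t\ge 1}$ is a sequence of measurable kernels from $\mathcal Z_t$ to $\mathcal A\cup\{a_{\rm stop}\}$, where choosing $a_{\rm stop}$ ends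 the interaction; $\mathcal D_t$ is the trajectory at time $t$ and $\tau=\inf\{t\ge 1:a_t=a_{\rm stop}\}\in\mathbb N\cup\{\infty\}$. An inference rule is a sequence $I=(I_t)_{t\ge 1}$ of measurable maps $\mathcal Z_t\to\mathcal H$. Probabilities $\mathbb P^\pi$ and expectations $\mathbb E^\pi$ include the draw of $\omega$, and events concerning $\mathcal D_\tau$ are understood on $\{\tau<\infty\}$. The posterior of $\omega$ given $\mathcal D_t=z$ is the normalized product of the prior and of the likelihood $p^\omega_0(x_1)\prod_{s<t}p^\omega_s(x_{s+1}\mid z_s,a_s)$ (and the prior where this cannot be normalized); it does not depend on the policy. Let $\mathbb P_t(H^\star=H\mid z)$ be the induced posterior of $H^\star$, $r_t(z)=\max_{H}\mathbb P_t(H^\star=H\mid z)$, and let $\bar P_t(\cdot\mid z,a)$ be the posterior mixture of the kernels $P_t^\omega(\cdot\mid z,a)$. For $\delta\in(0,1)$ and $\lambda\ge 0$ put $$V_\lambda(\pi,I)=-\mathbb E^\pi[\tau]+\lambda\big(\mathbb P^\pi(I_\tau(\mathcal D_\tau)=H^\star)-1+\delta\big)\in[-\infty,\infty).$$ Let $V_{t,\lambda}(z)=\sup_\pi\mathbb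 E^\pi[-(\tau-t)+\lambda r_\tau(\mathcal D_\tau)\mid \mathcal D_t=z,\ \tau\ge t]$ be the optimal value to go (where, given $\mathcal D_t=z$, later observations are drawn from the kernels $\bar P_s$), and $$Q_{t,\lambda}(z,a_{\rm stop})=\lambda r_t(z),\qquad Q_{t,\lambda}(z,a)=-1+\int V_{t+1,\lambda}(z,a,x)\,\bar P_t(dx\mid z,a)\quad(a\in\mathcal A).$$ **Theorem.** (1) For every $\lambda\ge 0$, the functions $Q_{t,\lambda}$ satisfy $$Q_{t,\lambda}(z,a)=-1+\int \max_{a'\in\mathcal A\cup\{a_{\rm stop}\}}Q_{t+1,\lambda}\big((z,a,x),a'\big)\,\bar P_t(dx\mid z,a),\qquad a\in\mathcal A,\ z\in\mathcal Z_t,\ t\ge 1,$$ where the integrand is integrable. There exist a deterministic greedy policy (one that only plays maximizers of $Q_{t,\lambda}(z,\cdot)$) and a maximum a posteriori inference rule ($I_t(z)\in\arg\max_H\mathbb P_t(H^\star=H\mid z)$). Every pair $(\pi^\star_\lambda,I^\star)$ of a policy that is greedy with respect to $Q_{t,\lambda}$ and a maximum a posteriori rule, with any tie-breaking, satisfies $V_\lambda(\pi^\star_\lambda,I^\star)=\sup_{\pi,I}V_\lambda(\pi,I)$.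 (2) Assume identifiability: for every $\varepsilon>0$ there is a policy $\pi$ with $\mathbb E^\pi[\tau]<\infty$ and $\mathbb E^\pi[r_\tau(\mathcal D_\tau)]\ge 1-\varepsilon$. Then the dual problem $\inf_{\lambda\ge 0}\sup_{\pi,I}V_\lambda(\pi,I)$ has an optimal $\lambda^\star\ge 0$. If $\lambda^\star$ is any optimal solution of it for which the maximizer $\pi$ of $-\mathbb E^\pi[\tau]+\lambda^\star(\mathbb E^\pi[r_\tau(\mathcal D_\tau)]-1+\delta)$ is unique, policies being identified when they induce the same joint law of $(\omega,\mathcal D_\tau)$ on $\{\tau<\infty\}$, then every greedy policy $\pi^\star_{\lambda^\star}$ with maximum a posteriori inference $I^\star$ is $\delta$-correct: $$\mathbb P^{\pi^\star_{\lambda^\star}}\big(I^\star_\tau(\mathcal D_\tau)=H^\star\big)\ge 1-\delta .$$ -/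

import Mathlib

open MeasureTheory ProbabilityTheory
open scoped ENNReal BoundedContinuousFunction

noncomputable section

namespace PureExploration

/-- Trajectories with `n` queries: the initial observation followed by `n` pairs
(query, observation). In one-based notation this is the space of `D_t`, with `t = n + 1`. -/
abbrev Hist (X A : Type*) (n : ℕ) : Type _ := X × (Fin n → A × X)

/-- The trajectory `(z, a, x)`. -/
def Hist.snoc {X A : Type*} {n : ℕ} (z : Hist X A n) (a : A) (x : X) : Hist X A (n + 1) :=
  (z.1, Fin.snoc (α := fun _ => A × X) z.2 (a, x))

/-- The trajectory with the last query and the last observation removed. -/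
def Hist.init {X A : Type*} {n : ℕ} (z : Hist X A (n + 1)) : Hist X A n :=
  (z.1, fun i => z.2 i.castSucc)

/-- Trajectories of arbitrary finite length; the values of `D_τ`. -/
abbrev Traj (X A : Type*) : Type _ := Σ n : ℕ, Hist X A n

section

variable {Ω X A 𝓗 : Type*} [MetricSpace Ω] [CompactSpace Ω] [MeasurableSpace Ω] [BorelSpace Ω]
  [MetricSpace X] [CompactSpace X] [MeasurableSpace X] [BorelSpace X]
  [Fintype A] [TopologicalSpace A] [DiscreteTopology A] [MeasurableSpace A]
  [DiscreteMeasurableSpace A]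
  [Fintype 𝓗] [MeasurableSpace 𝓗] [DiscreteMeasurableSpace 𝓗]

/-- A randomized policy on the action set `A ∪ {a_stop}`; the stop action is `none`. -/
structure Policy (X A : Type*) [MeasurableSpace X] [Fintype A] [MeasurableSpace A] where
  prob : (n : ℕ) → Hist X A n → Option A → ℝ≥0∞
  measurable_prob : ∀ n a, Measurable fun z => prob n z a
  sum_prob : ∀ n z, ∑ a, prob n z a = 1

/-- A sequence of inference rules. -/
structure InferenceRule (X A 𝓗 : Type*) [MeasurableSpace X] [MeasurableSpace A]
    [MeasurableSpace 𝓗] where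
  guess : (n : ℕ) → Hist X A n → 𝓗
  measurable_guess : ∀ n, Measurable (guess n)

/-- A Bayesian family of environments: a prior on a compact parameter space, initial laws and
history-dependent observation kernels, weakly continuous in all their arguments, and the
hypothesis which is true in the environment with parameter `ω`. -/
structure Model (Ω X A 𝓗 : Type*) [MetricSpace Ω] [MeasurableSpace Ω]
    [MetricSpace X] [MeasurableSpace X] [TopologicalSpace A] [MeasurableSpace A]
    [MeasurableSpace 𝓗] where
  prior : Measure Ω
  isProbabilityMeasure_prior : IsProbabilityMeasure prior
  init : Kernel Ω X
  isMarkovKernel_init : IsMarkovKernel init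
  trans : (n : ℕ) → Kernel (Ω × Hist X A n × A) X
  isMarkovKernel_trans : ∀ n, IsMarkovKernel (trans n)
  continuous_init : ∀ f : X →ᵇ ℝ, Continuous fun ω => ∫ x, f x ∂(init ω)
  continuous_trans : ∀ n, ∀ f : X →ᵇ ℝ, Continuous fun p => ∫ x, f x ∂(trans n p)
  truth : Ω → 𝓗
  measurable_truth : Measurable truth

/-- Domination of all initial laws by one probability measure and of all transition laws by
another one, with jointly measurable densities. -/
structure Model.Domination (M : Model Ω X A 𝓗) where
  base₀ : Measure X
  isProbabilityMeasure_base₀ : IsProbabilityMeasure base₀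
  base : Measure X
  isProbabilityMeasure_base : IsProbabilityMeasure base
  dens₀ : Ω → X → ℝ≥0∞
  measurable_dens₀ : Measurable fun p : Ω × X => dens₀ p.1 p.2
  init_eq : ∀ ω, M.init ω = base₀.withDensity (dens₀ ω)
  dens : (n : ℕ) → Ω × Hist X A n × A → X → ℝ≥0∞
  measurable_dens : ∀ n, Measurable fun p : (Ω × Hist X A n × A) × X => dens n p.1 p.2
  trans_eq : ∀ n p, M.trans n p = base.withDensity (dens n p)

/-! ### Laws of the interaction -/

/-- Start at time `n` with a trajectory of law `μ`, then choose queries by `π` and draw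
observations by `K`. This is the law of the trajectory `k` rounds later, restricted to the event
that the stop action was not chosen in these `k` rounds. -/
def runLaw (K : (n : ℕ) → Kernel (Hist X A n × A) X) (π : Policy X A) (n : ℕ)
    (μ : Measure (Hist X A n)) : (k : ℕ) → Measure (Hist X A (n + k))
  | 0 => μ
  | k + 1 => ∑ a : A,
      (((runLaw K π n μ k).withDensity fun z => π.prob (n + k) z (some a)) ⊗ₘ
        (K (n + k)).comap (fun z => (z, a)) (by fun_prop)).map
          fun p : Hist X A (n + k) × X => (p.1.snoc a p.2 : Hist X A (n + k + 1))

/-- The law of the trajectory `D_τ` at the first time `τ` at which the stop action is chosen,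
restricted to the event `τ < ∞`; the missing mass is the probability of `τ = ∞`. -/
def stoppedLaw (K : (n : ℕ) → Kernel (Hist X A n × A) X) (π : Policy X A) (n : ℕ)
    (μ : Measure (Hist X A n)) : Measure (Traj X A) :=
  Measure.sum fun k =>
    ((runLaw K π n μ k).withDensity fun z => π.prob (n + k) z none).map
      fun z => (⟨n + k, z⟩ : Traj X A)

/-- Joint law of the environment `ω ∼ prior` and of `D_τ`, restricted to `τ < ∞`. -/
def Model.pathLaw (M : Model Ω X A 𝓗) (π : Policy X A) : Measure (Ω × Traj X A) :=
  M.prior.bind fun ω =>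
    (Measure.dirac ω).prod (stoppedLaw (fun n => (M.trans n).sectR ω) π 0
      ((M.init ω).map fun x => ((x, Fin.elim0) : Hist X A 0)))

/-- `E[τ] = ∑ t * P(τ = t) + ∞ * P(τ = ∞)`; a stopped trajectory with `n` queries has
`τ = n + 1`. -/
def Model.expTau (M : Model Ω X A 𝓗) (π : Policy X A) : ℝ≥0∞ :=
  ∫⁻ p, ((p.2.1 + 1 : ℕ) : ℝ≥0∞) ∂(M.pathLaw π) + ⊤ * (1 - M.pathLaw π Set.univ)

/-- `P(I_τ(D_τ) = H⋆)`. -/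
def Model.correctness (M : Model Ω X A 𝓗) (π : Policy X A) (I : InferenceRule X A 𝓗) : ℝ :=
  (M.pathLaw π).real {p | I.guess p.2.1 p.2.2 = M.truth p.1}

/-- `V_λ(π, I) = -E[τ] + λ (P(I_τ(D_τ) = H⋆) - 1 + δ)`, equal to `-∞` if `E[τ] = ∞`. -/
def Model.lagrangian (M : Model Ω X A 𝓗) (δ lam : ℝ) (π : Policy X A)
    (I : InferenceRule X A 𝓗) : EReal :=
  -(M.expTau π : EReal) + ((lam * (M.correctness π I - 1 + δ) : ℝ) : EReal)

/-- The dual function `λ ↦ sup_{π, I} V_λ(π, I)`. -/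
def Model.dual (M : Model Ω X A 𝓗) (δ lam : ℝ) : EReal :=
  ⨆ π : Policy X A, ⨆ I : InferenceRule X A 𝓗, M.lagrangian δ lam π I

/-- `lam` attains the infimum in the dual problem `inf_{λ ≥ 0} sup_{π, I} V_λ(π, I)`. -/
def Model.IsDualOptimal (M : Model Ω X A 𝓗) (δ lam : ℝ) : Prop :=
  0 ≤ lam ∧ ∀ lam', 0 ≤ lam' → M.dual δ lam ≤ M.dual δ lam'

/-! ### Posterior -/

namespace Model.Domination

variable {M : Model Ω X A 𝓗} (D : M.Domination)

/-- The likelihood of a trajectory under the environment `ω`. -/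
def likelihood : (n : ℕ) → Ω → Hist X A n → ℝ≥0∞
  | 0, ω, z => D.dens₀ ω z.1
  | n + 1, ω, z => likelihood n ω z.init *
      D.dens n (ω, z.init, (z.2 (Fin.last n)).1) (z.2 (Fin.last n)).2

/-- The marginal likelihood of a trajectory. -/
def evidence (n : ℕ) (z : Hist X A n) : ℝ≥0∞ := ∫⁻ ω, D.likelihood n ω z ∂M.prior

theorem measurable_likelihood (n : ℕ) :
    Measurable fun p : Hist X A n × Ω => D.likelihood n p.2 p.1 := by
  induction n with
  | zero =>
    exact D.measurable_dens₀.comp (f := fun p : Hist X A 0 × Ω => (p.2, p.1.1)) (by fun_prop)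
  | succ n ih =>
    have h1 : Measurable fun p : Hist X A (n + 1) × Ω => ((p.1.init : Hist X A n), p.2) := by
      unfold Hist.init; fun_prop
    have h2 : Measurable fun p : Hist X A (n + 1) × Ω =>
        ((p.2, (p.1.init : Hist X A n), (p.1.2 (Fin.last n)).1), (p.1.2 (Fin.last n)).2) := by
      unfold Hist.init; fun_prop
    exact (ih.comp h1).mul ((D.measurable_dens n).comp h2)

open Classical in
/-- The posterior law of the environment given the trajectory: normalized likelihood times prior.
On the trajectories that cannot be normalized (a null set under every policy) it is the prior. -/
def posterior (n : ℕ) : Kernel (Hist X A n) Ω where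
  toFun z := if D.evidence n z = 0 ∨ D.evidence n z = ⊤ then M.prior
    else (D.evidence n z)⁻¹ • M.prior.withDensity fun ω => D.likelihood n ω z
  measurable' := by
    have := M.isProbabilityMeasure_prior
    have hev : Measurable (D.evidence n) := (D.measurable_likelihood n).lintegral_prod_right'
    refine Measurable.ite ?_ measurable_const ?_
    · exact (hev (measurableSet_singleton 0)).union (hev (measurableSet_singleton ⊤))
    · refine Measure.measurable_of_measurable_coe _ fun s hs => ?_
      simp only [Measure.smul_apply, smul_eq_mul, withDensity_apply _ hs]
      exact hev.inv.mul (D.measurable_likelihood n).lintegral_prod_right'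

/-- `P(H⋆ = H | D = z)`. -/
def hypPosterior (n : ℕ) (z : Hist X A n) (H : 𝓗) : ℝ :=
  (D.posterior n z).real (M.truth ⁻¹' {H})

/-- `r(z) = max_H P(H⋆ = H | D = z)`. -/
def maxPosterior (n : ℕ) (z : Hist X A n) : ℝ := ⨆ H : 𝓗, D.hypPosterior n z H

/-- The posterior mixture of the observation kernels: the law of the next observation given the
trajectory and the query. -/
def predictive (n : ℕ) : Kernel (Hist X A n × A) X :=
  M.trans n ∘ₖ ((D.posterior n).comap Prod.fst measurable_fst ×ₖ Kernel.id)

/-! ### Values -/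

/-- The conditional law of `D_τ`, restricted to `τ < ∞`, given `D_t = z` and `τ ≥ t`. -/
def condLaw (n : ℕ) (z : Hist X A n) (π : Policy X A) : Measure (Traj X A) :=
  stoppedLaw D.predictive π n (Measure.dirac z)

/-- `E^π[τ - t | D_t = z, τ ≥ t]`. -/
def expRemaining (n : ℕ) (z : Hist X A n) (π : Policy X A) : ℝ≥0∞ :=
  ∫⁻ o, ((o.1 - n : ℕ) : ℝ≥0∞) ∂(D.condLaw n z π) + ⊤ * (1 - D.condLaw n z π Set.univ)

/-- `E^π[-(τ - t) + λ r_τ(D_τ) | D_t = z, τ ≥ t]`, equal to `-∞` if the conditional expectation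
of `τ` is infinite. -/
def policyValue (lam : ℝ) (n : ℕ) (z : Hist X A n) (π : Policy X A) : EReal :=
  -(D.expRemaining n z π : EReal) +
    ((lam * ∫ o, D.maxPosterior o.1 o.2 ∂(D.condLaw n z π) : ℝ) : EReal)

/-- The optimal value to go. -/
def value (lam : ℝ) (n : ℕ) (z : Hist X A n) : ℝ :=
  (⨆ π : Policy X A, D.policyValue lam n z π).toReal

/-- The optimal action values `Q_{t,λ}`: a query costs `1` and is followed by optimal play, the
stop action earns `λ` times the maximal posterior probability. -/
def qValue (lam : ℝ) (n : ℕ) (z : Hist X A n) : Option A → ℝ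
  | none => lam * D.maxPosterior n z
  | some a => -1 + ∫ x, D.value lam (n + 1) (z.snoc a x) ∂(D.predictive n (z, a))

/-- The policy only plays actions that maximize `Q_{t,λ}` (arbitrary tie-breaking). -/
def IsGreedy (lam : ℝ) (π : Policy X A) : Prop :=
  ∀ n z a, π.prob n z a ≠ 0 → ∀ b, D.qValue lam n z b ≤ D.qValue lam n z a

/-- Maximum a posteriori inference (arbitrary tie-breaking). -/
def IsMAP (I : InferenceRule X A 𝓗) : Prop :=
  ∀ n z H, D.hypPosterior n z H ≤ D.hypPosterior n z (I.guess n z)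

/-- `E^π[r_τ(D_τ)]`. -/
def expMaxPosterior (π : Policy X A) : ℝ :=
  ∫ p, D.maxPosterior p.2.1 p.2.2 ∂(M.pathLaw π)

/-- Identifiability: every confidence level below one is reached in finite expected time. -/
def Identifiable : Prop :=
  ∀ ε : ℝ, 0 < ε → ∃ π : Policy X A, M.expTau π < ⊤ ∧ 1 - ε ≤ D.expMaxPosterior π

/-- `V_λ(π) = -E[τ] + λ (E[r_τ(D_τ)] - 1 + δ)`. -/
def policyLagrangian (δ lam : ℝ) (π : Policy X A) : EReal :=
  -(M.expTau π : EReal) + ((lam * (D.expMaxPosterior π - 1 + δ) : ℝ) : EReal)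

/-- `π` maximizes `V_λ`. -/
def IsOptimalPolicy (δ lam : ℝ) (π : Policy X A) : Prop :=
  ∀ π' : Policy X A, D.policyLagrangian δ lam π' ≤ D.policyLagrangian δ lam π

/-- The `λ`-optimal policy is unique, where two policies are identified if they generate the same
law of the environment and the stopped trajectory (they differ only where they are never
used). -/
def UniqueOptimalPolicy (δ lam : ℝ) : Prop :=
  ∀ π π' : Policy X A, D.IsOptimalPolicy δ lam π → D.IsOptimalPolicy δ lam π' →
    M.pathLaw π = M.pathLaw π'

end Model.Domination

end

end PureExploration

end

open PureExploration

/-!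
Stopping with reward `l * r` and paying `1` per query is an optimal stopping problem; its value
is the increasing limit of value iteration from `0`, and it solves the Bellman equation. Since
`0 ≤ value ≤ l`, a policy that loses nothing at any round attains the value as soon as its expected
number of queries is finite, which greediness forces because each query costs `1`.

Bayes' rule turns the average of the environments into this problem: averaged over the prior, the
likelihood ratios against the dominating measures give the posterior predictive kernels, so the law
of the stopped trajectory is generated by the predictive kernels, and the environment is drawn from
the posterior given that trajectory. Maximum a posteriori inference then earns the maximal
posterior, and the Lagrangian is the mean payoff of the stopping problem up to a constant.

In `l` the dual function is Lipschitz, and it is coercive when some policy of finite expected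
duration has confidence above `1 - δ`, so it has a minimizer. There its right derivative is
nonnegative, so the right derivative of the mean value is at least `1 - δ`. The right derivatives
of the values obey the Bellman recursion restricted to optimal actions, hence the greedy policy
that maximizes them among the optimal actions has confidence at least `1 - δ`; by uniqueness all
greedy policies do.
-/

namespace PureExploration

open Filter
open scoped NNReal Topology

section Trajectories

variable {X A : Type*} {n : ℕ}

theorem Hist.init_snoc (z : Hist X A n) (a : A) (x : X) : (z.snoc a x).init = z := by
  ext i <;> simp [Hist.init, Hist.snoc]

theorem Hist.snoc_last (z : Hist X A n) (a : A) (x : X) :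
    (z.snoc a x).2 (Fin.last n) = (a, x) := by
  simp [Hist.snoc]

variable [MeasurableSpace X] [MeasurableSpace A]

theorem measurable_snoc (a : A) : Measurable fun p : Hist X A n × X => p.1.snoc a p.2 := by
  refine Measurable.prodMk (by fun_prop) (measurable_pi_lambda _ fun i => ?_)
  refine Fin.lastCases ?_ (fun j => ?_) i
  · simpa only [Fin.snoc_last] using measurable_const.prodMk measurable_snd
  · simp only [Fin.snoc_castSucc]
    fun_prop

theorem measurable_snoc_right (z : Hist X A n) (a : A) : Measurable (z.snoc a) :=
  (measurable_snoc a).comp measurable_prodMk_left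

theorem measurable_trajMk (n : ℕ) : Measurable fun z : Hist X A n => (⟨n, z⟩ : Traj X A) :=
  Measurable.of_le_map (iInf_le _ n)

theorem measurable_traj {β : Type*} [MeasurableSpace β] {f : Traj X A → β}
    (h : ∀ n, Measurable fun z => f ⟨n, z⟩) : Measurable f := by
  intro s hs
  rw [MeasurableSpace.measurableSet_iInf]
  exact fun n => h n hs

theorem measurableEmbedding_trajMk (n : ℕ) :
    MeasurableEmbedding fun z : Hist X A n => (⟨n, z⟩ : Traj X A) where
  injective := sigma_mk_injective
  measurable := measurable_trajMk n
  measurableSet_image' s hs := by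
    rw [MeasurableSpace.measurableSet_iInf]
    intro m
    change MeasurableSet (Sigma.mk m ⁻¹' (Sigma.mk n '' s))
    rcases eq_or_ne n m with rfl | hnm
    · rwa [Set.preimage_image_eq s sigma_mk_injective]
    · rw [Set.preimage_image_sigmaMk_of_ne hnm.symm]
      exact MeasurableSet.empty

theorem measurable_prod_traj {β γ : Type*} [MeasurableSpace β] [MeasurableSpace γ]
    {f : β × Traj X A → γ} (h : ∀ n, Measurable fun p : β × Hist X A n => f (p.1, ⟨n, p.2⟩)) :
    Measurable f := by
  intro s hs
  have hcover : f ⁻¹' s = ⋃ n, (Prod.map id fun z : Hist X A n => (⟨n, z⟩ : Traj X A)) ''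
      ((fun p : β × Hist X A n => f (p.1, ⟨n, p.2⟩)) ⁻¹' s) := by
    ext ⟨b, n, z⟩
    simp only [Set.mem_preimage, Set.mem_iUnion, Set.mem_image, Prod.exists, Prod.map_apply, id]
    exact ⟨fun hb => ⟨n, b, z.1, z.2, hb, rfl⟩, fun ⟨_, _, _, _, hb, he⟩ => he ▸ hb⟩
  rw [hcover]
  exact MeasurableSet.iUnion fun n =>
    (MeasurableEmbedding.id.prodMap (measurableEmbedding_trajMk n)).measurableSet_image' (h n hs)

end Trajectories

theorem exists_measurable_selection {β ι : Type*} [MeasurableSpace β] [Countable ι]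
    {p : β → ι → Prop} (hp : ∀ z, ∃ i, p z i) (hm : ∀ i, MeasurableSet {z | p z i}) :
    ∃ f : β → ι, (∀ s : Set ι, MeasurableSet (f ⁻¹' s)) ∧ ∀ z, p z (f z) := by
  classical
  rcases isEmpty_or_nonempty β with _ | ⟨⟨z₀⟩⟩
  · exact ⟨isEmptyElim, fun s => Subsingleton.measurableSet, fun z => isEmptyElim z⟩
  have : Nonempty ι := (hp z₀).nonempty
  obtain ⟨e, he⟩ := exists_surjective_nat ι
  have hfind : ∀ z, ∃ k, p z (e k) := fun z => he.exists.1 (hp z)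
  refine ⟨fun z => e (Nat.find (hfind z)), fun s => ?_, fun z => Nat.find_spec (hfind z)⟩
  exact measurable_find hfind (fun k => hm (e k)) (MeasurableSet.of_discrete (s := e ⁻¹' s))

section Sequences

theorem tsum_tsum_tail (s : ℕ → ℝ≥0∞) :
    ∑' k, ∑' j, s (j + (k + 1)) = ∑' j : ℕ, (j : ℝ≥0∞) * s j := by
  calc
    _ = ∑' p : ℕ × ℕ, s (p.2 + (p.1 + 1)) := ENNReal.tsum_prod.symm
    _ = ∑' q : Σ n : ℕ, Finset.HasAntidiagonal.antidiagonal n, s (q.1 + 1) := by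
      rw [← Finset.HasAntidiagonal.sigmaAntidiagonalEquivProd.tsum_eq]
      refine tsum_congr fun ⟨n, p, hp⟩ => congrArg s ?_
      have := Finset.HasAntidiagonal.mem_antidiagonal.1 hp
      simp only [Finset.HasAntidiagonal.sigmaAntidiagonalEquivProd_apply]
      omega
    _ = ∑' n : ℕ, ((n + 1 : ℕ) : ℝ≥0∞) * s (n + 1) := by
      rw [ENNReal.tsum_sigma']
      simp
    _ = ∑' j : ℕ, (j : ℝ≥0∞) * s j := by
      rw [tsum_eq_zero_add' (f := fun j : ℕ => (j : ℝ≥0∞) * s j) ENNReal.summable]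
      simp

variable {m s : ℕ → ℝ≥0∞}

theorem sum_range_add_eq (h : ∀ k, m k = s k + m (k + 1)) (N k : ℕ) :
    ∑ j ∈ Finset.range N, s (j + k) + m (N + k) = m k := by
  induction N with
  | zero => simp
  | succ N ih =>
    rw [← ih, h (N + k), Finset.sum_range_succ, add_assoc, add_right_comm N 1 k]

theorem eq_tsum_add_iInf (h : ∀ k, m k = s k + m (k + 1)) (k : ℕ) :
    m k = ∑' j, s (j + k) + ⨅ i, m i := by
  have hanti : Antitone m := antitone_nat_of_succ_le fun k => by rw [h k]; exact le_add_self
  have hlim := (ENNReal.tendsto_nat_tsum fun j => s (j + k)).add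
    ((tendsto_add_atTop_iff_nat k).2 (tendsto_atTop_iInf hanti))
  simp only [sum_range_add_eq h] at hlim
  exact tendsto_nhds_unique tendsto_const_nhds hlim

/-- The tail sum formula for a possibly infinite time: `m k` is the probability to survive `k`
rounds, `s k` the probability to stop right after them. -/
theorem tsum_mul_add_top_mul_one_sub_tsum (h : ∀ k, m k = s k + m (k + 1)) (h0 : m 0 = 1) :
    ∑' k : ℕ, (k : ℝ≥0∞) * s k + ⊤ * (1 - ∑' k, s k) = ∑' k, m (k + 1) := by
  have hone : 1 = ∑' k, s k + ⨅ k, m k := h0 ▸ eq_tsum_add_iInf h 0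
  have hsub : 1 - ∑' k, s k = ⨅ k, m k :=
    ENNReal.sub_eq_of_eq_add_rev (ne_top_of_le_ne_top ENNReal.one_ne_top
      (hone ▸ le_self_add)) hone
  rw [hsub, tsum_congr fun k => eq_tsum_add_iInf h (k + 1), ENNReal.tsum_add, tsum_tsum_tail,
    ENNReal.tsum_const]
  simp

variable {M : Type*} [AddCommMonoid M] [PartialOrder M] [IsOrderedAddMonoid M] {a b g : ℕ → M}

theorem sum_range_add_le (h : ∀ k, a k + g (k + 1) ≤ g k + b k) (k : ℕ) :
    ∑ j ∈ Finset.range k, a j + g k ≤ g 0 + ∑ j ∈ Finset.range k, b j := by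
  induction k with
  | zero => simp
  | succ k ih =>
    calc
      _ = ∑ j ∈ Finset.range k, a j + (a k + g (k + 1)) := by
        rw [Finset.sum_range_succ, add_assoc]
      _ ≤ ∑ j ∈ Finset.range k, a j + (g k + b k) := add_le_add le_rfl (h k)
      _ ≤ g 0 + ∑ j ∈ Finset.range k, b j + b k := by rw [← add_assoc]; gcongr
      _ = _ := by rw [Finset.sum_range_succ, add_assoc]

theorem le_sum_range_add (h : ∀ k, g k + b k ≤ a k + g (k + 1)) (k : ℕ) :
    g 0 + ∑ j ∈ Finset.range k, b j ≤ ∑ j ∈ Finset.range k, a j + g k :=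
  sum_range_add_le (M := Mᵒᵈ) h k

end Sequences

noncomputable section Runs

/-- A nonnegative quantity attached to every trajectory, such as a terminal reward or a
potential. -/
abbrev Payoff (X A : Type*) : Type _ := (n : ℕ) → Hist X A n → ℝ≥0∞

section Action

variable {X A : Type*} [MeasurableSpace X] [MeasurableSpace A]
  (K : (n : ℕ) → Kernel (Hist X A n × A) X) {f G : Payoff X A}

/-- The expected payoff of an action: `f` is paid upon stopping, `G` after the next observation. -/
def actionPayoff (f G : Payoff X A) (n : ℕ) (z : Hist X A n) : Option A → ℝ≥0∞
  | none => f n z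
  | some a => ∫⁻ x, G (n + 1) (z.snoc a x) ∂K n (z, a)

theorem measurable_lintegral_snoc {n : ℕ} [IsSFiniteKernel (K n)] {g : Hist X A (n + 1) → ℝ≥0∞}
    (hg : Measurable g) (a : A) : Measurable fun z => ∫⁻ x, g (z.snoc a x) ∂K n (z, a) :=
  Measurable.lintegral_kernel_prod_right (κ := (K n).comap (fun z => (z, a)) (by fun_prop))
    (f := fun z x => g (z.snoc a x)) (hg.comp (measurable_snoc a))

theorem measurable_actionPayoff [∀ n, IsSFiniteKernel (K n)] (hf : ∀ n, Measurable (f n))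
    (hG : ∀ n, Measurable (G n)) (n : ℕ) (b : Option A) :
    Measurable fun z => actionPayoff K f G n z b := by
  cases b with
  | none => exact hf n
  | some a => exact measurable_lintegral_snoc K (hG _) a

end Action

variable {X A : Type*} [MeasurableSpace X] [Fintype A] [MeasurableSpace A]

section Policy

variable (π : Policy X A) {n : ℕ} {z : Hist X A n} {q : Option A → ℝ≥0∞} {v : ℝ≥0∞}

theorem Policy.sum_prob_mul_le (h : ∀ b, q b ≤ v) : ∑ b, π.prob n z b * q b ≤ v := by
  calc
    _ ≤ ∑ b, π.prob n z b * v := Finset.sum_le_sum fun b _ => by gcongr; exact h b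
    _ = v := by rw [← Finset.sum_mul, π.sum_prob, one_mul]

theorem Policy.le_sum_prob_mul (h : ∀ b, π.prob n z b ≠ 0 → v ≤ q b) :
    v ≤ ∑ b, π.prob n z b * q b := by
  calc
    v = ∑ b, π.prob n z b * v := by rw [← Finset.sum_mul, π.sum_prob, one_mul]
    _ ≤ _ := Finset.sum_le_sum fun b _ => by
      rcases eq_or_ne (π.prob n z b) 0 with hb | hb
      · simp [hb]
      · gcongr
        exact h b hb

end Policy

/-- The expected number of further queries, as the sum of the survival probabilities. -/
def expQueries (K : (n : ℕ) → Kernel (Hist X A n × A) X) (π : Policy X A) (n : ℕ)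
    (μ : Measure (Hist X A n)) : ℝ≥0∞ :=
  ∑' k, runLaw K π n μ (k + 1) Set.univ

variable (K : (n : ℕ) → Kernel (Hist X A n × A) X) (π : Policy X A) {n : ℕ}
  (μ : Measure (Hist X A n)) {f G : Payoff X A}

theorem lintegral_stoppedLaw (hf : ∀ n, Measurable (f n)) :
    ∫⁻ o, f o.1 o.2 ∂stoppedLaw K π n μ =
      ∑' k, ∫⁻ z, π.prob (n + k) z none * f (n + k) z ∂runLaw K π n μ k := by
  rw [stoppedLaw, lintegral_sum_measure]
  refine tsum_congr fun k => ?_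
  rw [lintegral_map (measurable_traj hf) (measurable_trajMk _)]
  exact lintegral_withDensity_eq_lintegral_mul _ (π.measurable_prob _ _) (hf _)

theorem stoppedLaw_univ :
    stoppedLaw K π n μ Set.univ = ∑' k, ∫⁻ z, π.prob (n + k) z none ∂runLaw K π n μ k := by
  simpa only [lintegral_one, mul_one] using
    lintegral_stoppedLaw K π μ (f := fun _ _ => 1) fun _ => measurable_const

variable [SFinite μ]

instance sFinite_runLaw (k : ℕ) : SFinite (runLaw K π n μ k) := by
  induction k with
  | zero => assumption
  | succ k _ =>
    rw [runLaw, ← Measure.sum_fintype]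
    infer_instance

instance sFinite_stoppedLaw : SFinite (stoppedLaw K π n μ) := by
  unfold stoppedLaw
  infer_instance

variable [∀ n, IsSFiniteKernel (K n)]

theorem lintegral_runLaw_succ (k : ℕ) {g : Hist X A (n + k + 1) → ℝ≥0∞} (hg : Measurable g) :
    ∫⁻ z, g z ∂runLaw K π n μ (k + 1) =
      ∑ a, ∫⁻ z, π.prob (n + k) z (some a) * ∫⁻ x, g (z.snoc a x) ∂K (n + k) (z, a)
        ∂runLaw K π n μ k := by
  rw [runLaw, lintegral_finsetSum_measure]
  refine Finset.sum_congr rfl fun a _ => ?_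
  refine (lintegral_map hg (measurable_snoc a)).trans ?_
  refine (Measure.lintegral_compProd (hg.comp (measurable_snoc a))).trans ?_
  exact lintegral_withDensity_eq_lintegral_mul _ (π.measurable_prob _ _)
    (measurable_lintegral_snoc K hg a)

theorem lintegral_sum_prob_mul_actionPayoff (hf : ∀ n, Measurable (f n))
    (hG : ∀ n, Measurable (G n)) (k : ℕ) :
    ∫⁻ z, ∑ b, π.prob (n + k) z b * actionPayoff K f G (n + k) z b ∂runLaw K π n μ k =
      ∫⁻ z, π.prob (n + k) z none * f (n + k) z ∂runLaw K π n μ k +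
        ∫⁻ z, G (n + k + 1) z ∂runLaw K π n μ (k + 1) := by
  have hm (b : Option A) :
      Measurable fun z => π.prob (n + k) z b * actionPayoff K f G (n + k) z b :=
    (π.measurable_prob _ b).mul (measurable_actionPayoff K hf hG _ b)
  rw [lintegral_finsetSum _ fun b _ => hm b, Fintype.sum_option,
    lintegral_runLaw_succ K π μ k (hG _)]
  rfl

end Runs

section MarkovRuns

variable {X A : Type*} [MeasurableSpace X] [Fintype A] [MeasurableSpace A]
  {K : (n : ℕ) → Kernel (Hist X A n × A) X} [∀ n, IsMarkovKernel (K n)] {π : Policy X A} {n : ℕ}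
  {μ : Measure (Hist X A n)}

section SFinite

variable [SFinite μ]

theorem runLaw_univ (k : ℕ) :
    runLaw K π n μ k Set.univ =
      ∫⁻ z, π.prob (n + k) z none ∂runLaw K π n μ k + runLaw K π n μ (k + 1) Set.univ := by
  have h := lintegral_sum_prob_mul_actionPayoff K π μ (f := fun _ _ => 1) (G := fun _ _ => 1)
    (fun _ => measurable_const) (fun _ => measurable_const) k
  have hone (z : Hist X A (n + k)) (b : Option A) :
      actionPayoff K (fun _ _ => 1) (fun _ _ => 1) (n + k) z b = 1 := by
    cases b <;> simp [actionPayoff]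
  simpa only [hone, mul_one, π.sum_prob, lintegral_one] using h

theorem stoppedLaw_univ_le : stoppedLaw K π n μ Set.univ ≤ μ Set.univ := by
  rw [stoppedLaw_univ]
  exact le_self_add.trans_eq (eq_tsum_add_iInf (runLaw_univ (K := K) (π := π) (μ := μ)) 0).symm

variable [IsProbabilityMeasure μ]

theorem lintegral_length_stoppedLaw :
    ∫⁻ o, ((o.1 - n : ℕ) : ℝ≥0∞) ∂stoppedLaw K π n μ + ⊤ * (1 - stoppedLaw K π n μ Set.univ) =
      expQueries K π n μ := by
  rw [lintegral_stoppedLaw K π μ (f := fun m _ => ((m - n : ℕ) : ℝ≥0∞)) fun _ => measurable_const,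
    stoppedLaw_univ, expQueries,
    ← tsum_mul_add_top_mul_one_sub_tsum (runLaw_univ (K := K) (π := π)) (measure_univ (μ := μ))]
  simp only [Nat.add_sub_cancel_left, lintegral_mul_const _ (π.measurable_prob _ _),
    mul_comm ((_ : ℕ) : ℝ≥0∞)]

theorem one_sub_stoppedLaw_univ_eq_zero (h : expQueries K π n μ ≠ ⊤) :
    1 - stoppedLaw K π n μ Set.univ = 0 := by
  rw [← lintegral_length_stoppedLaw] at h
  by_contra h'
  exact h (by rw [ENNReal.top_mul h', add_top])

end SFinite

section Verification

variable [IsFiniteMeasure μ] {f G : Payoff X A} {c : ℝ≥0}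

theorem antitone_runLaw_univ : Antitone fun k => runLaw K π n μ k Set.univ :=
  antitone_nat_of_succ_le fun k => by rw [runLaw_univ k]; exact le_add_self

theorem mul_lintegral_prob_none_ne_top (k : ℕ) :
    c * ∫⁻ z, π.prob (n + k) z none ∂runLaw K π n μ k ≠ ⊤ := by
  refine ENNReal.mul_ne_top ENNReal.coe_ne_top (ne_top_of_le_ne_top (measure_ne_top μ Set.univ) ?_)
  calc
    _ ≤ runLaw K π n μ k Set.univ := by rw [runLaw_univ k]; exact le_self_add
    _ ≤ μ Set.univ := antitone_runLaw_univ k.zero_le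

theorem lintegral_sum_prob_mul_actionPayoff_add (hf : ∀ n, Measurable (f n))
    (hG : ∀ n, Measurable (G n)) (k : ℕ) :
    ∫⁻ z, ∑ b, π.prob (n + k) z b * actionPayoff K (fun n z => f n z + c) G (n + k) z b
        ∂runLaw K π n μ k =
      c * ∫⁻ z, π.prob (n + k) z none ∂runLaw K π n μ k +
        (∫⁻ z, π.prob (n + k) z none * f (n + k) z ∂runLaw K π n μ k +
          ∫⁻ z, G (n + k + 1) z ∂runLaw K π n μ (k + 1)) := by
  rw [← add_assoc, ← lintegral_const_mul _ (π.measurable_prob _ _),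
    ← lintegral_add_left ((π.measurable_prob _ _).const_mul _)]
  refine (lintegral_sum_prob_mul_actionPayoff K π μ (fun n => (hf n).add_const _) hG k).trans ?_
  simp only [mul_add, mul_comm (c : ℝ≥0∞), add_comm]

theorem lintegral_add_const_runLaw (k : ℕ) :
    ∫⁻ z, (G (n + k) z + c) ∂runLaw K π n μ k =
      c * ∫⁻ z, π.prob (n + k) z none ∂runLaw K π n μ k +
        (∫⁻ z, G (n + k) z ∂runLaw K π n μ k + c * runLaw K π n μ (k + 1) Set.univ) := by
  rw [lintegral_add_right _ measurable_const, lintegral_const, runLaw_univ k]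
  ring

/-- The last hypothesis makes `G` a supermartingale along the run, up to a drift of `c` per
query. -/
theorem lintegral_stoppedLaw_le (hf : ∀ n, Measurable (f n)) (hG : ∀ n, Measurable (G n))
    (h : ∀ n z, ∑ b, π.prob n z b * actionPayoff K (fun n z => f n z + c) G n z b ≤ G n z + c) :
    ∫⁻ o, f o.1 o.2 ∂stoppedLaw K π n μ ≤ ∫⁻ z, G n z ∂μ + c * expQueries K π n μ := by
  rw [lintegral_stoppedLaw K π μ hf, expQueries, ← ENNReal.tsum_mul_left]
  refine ENNReal.tsum_le_of_sum_range_le fun k => ?_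
  refine le_self_add.trans ((sum_range_add_le
    (g := fun k => ∫⁻ z, G (n + k) z ∂runLaw K π n μ k) (fun k => ?_) k).trans
    (add_le_add le_rfl (ENNReal.sum_le_tsum _)))
  have hk := lintegral_mono (μ := runLaw K π n μ k) (h (n + k))
  rw [lintegral_sum_prob_mul_actionPayoff_add hf hG, lintegral_add_const_runLaw] at hk
  exact ENNReal.le_of_add_le_add_left (mul_lintegral_prob_none_ne_top k) hk

theorem lintegral_add_le_sum_runLaw (hf : ∀ n, Measurable (f n)) (hG : ∀ n, Measurable (G n))
    (h : ∀ n z, G n z + c ≤ ∑ b, π.prob n z b * actionPayoff K (fun n z => f n z + c) G n z b)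
    (k : ℕ) :
    ∫⁻ z, G n z ∂μ + ∑ j ∈ Finset.range k, c * runLaw K π n μ (j + 1) Set.univ ≤
      ∑ j ∈ Finset.range k, ∫⁻ z, π.prob (n + j) z none * f (n + j) z ∂runLaw K π n μ j +
        ∫⁻ z, G (n + k) z ∂runLaw K π n μ k := by
  refine le_sum_range_add (g := fun k => ∫⁻ z, G (n + k) z ∂runLaw K π n μ k) (fun k => ?_) k
  have hk := lintegral_mono (μ := runLaw K π n μ k) (h (n + k))
  rw [lintegral_sum_prob_mul_actionPayoff_add hf hG, lintegral_add_const_runLaw] at hk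
  exact ENNReal.le_of_add_le_add_left (mul_lintegral_prob_none_ne_top k) hk

variable {C : ℝ≥0}

theorem mul_expQueries_le (hf : ∀ n, Measurable (f n)) (hG : ∀ n, Measurable (G n))
    (hfC : ∀ n z, f n z ≤ C) (hGC : ∀ n z, G n z ≤ C)
    (h : ∀ n z, G n z + c ≤ ∑ b, π.prob n z b * actionPayoff K (fun n z => f n z + c) G n z b) :
    c * expQueries K π n μ ≤ C * μ Set.univ := by
  rw [expQueries, ← ENNReal.tsum_mul_left]
  refine ENNReal.tsum_le_of_sum_range_le fun k => ?_
  calc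
    _ ≤ ∑ j ∈ Finset.range k, ∫⁻ z, π.prob (n + j) z none * f (n + j) z ∂runLaw K π n μ j +
        ∫⁻ z, G (n + k) z ∂runLaw K π n μ k :=
      le_add_self.trans (lintegral_add_le_sum_runLaw hf hG h k)
    _ ≤ ∑ j ∈ Finset.range k, ∫⁻ z, π.prob (n + j) z none * C ∂runLaw K π n μ j +
        ∫⁻ _, C ∂runLaw K π n μ k := by
      gcongr with j _ z z
      exacts [hfC _ _, hGC _ _]
    _ = (∑ j ∈ Finset.range k, ∫⁻ z, π.prob (n + j) z none ∂runLaw K π n μ j +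
        runLaw K π n μ k Set.univ) * C := by
      simp only [lintegral_mul_const _ (π.measurable_prob _ _), lintegral_const, add_mul,
        Finset.sum_mul, mul_comm (C : ℝ≥0∞)]
    _ = C * μ Set.univ := (congrArg (· * (C : ℝ≥0∞))
      (sum_range_add_eq (runLaw_univ (K := K) (π := π) (μ := μ)) k 0)).trans (mul_comm _ _)

theorem le_lintegral_stoppedLaw (hf : ∀ n, Measurable (f n)) (hG : ∀ n, Measurable (G n))
    (hGC : ∀ n z, G n z ≤ C) (hq : expQueries K π n μ ≠ ⊤)
    (h : ∀ n z, G n z + c ≤ ∑ b, π.prob n z b * actionPayoff K (fun n z => f n z + c) G n z b) :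
    ∫⁻ z, G n z ∂μ + c * expQueries K π n μ ≤ ∫⁻ o, f o.1 o.2 ∂stoppedLaw K π n μ := by
  have hmass : Tendsto (fun k => C * runLaw K π n μ k Set.univ) atTop (𝓝 0) := by
    have h0 := (tendsto_add_atTop_iff_nat (f := fun k => runLaw K π n μ k Set.univ) 1).1
      (ENNReal.tendsto_atTop_zero_of_tsum_ne_top hq)
    simpa only [mul_zero] using ENNReal.Tendsto.const_mul h0 (.inr ENNReal.coe_ne_top)
  have hremainder : Tendsto (fun k => ∫⁻ z, G (n + k) z ∂runLaw K π n μ k) atTop (𝓝 0) := by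
    refine tendsto_of_tendsto_of_tendsto_of_le_of_le tendsto_const_nhds hmass
      (fun _ => zero_le) fun k => ?_
    exact (lintegral_mono (hGC _)).trans_eq (lintegral_const _)
  rw [lintegral_stoppedLaw K π μ hf, expQueries, ← ENNReal.tsum_mul_left]
  refine le_of_tendsto_of_tendsto' (tendsto_const_nhds.add (ENNReal.tendsto_nat_tsum _)) ?_
    (lintegral_add_le_sum_runLaw hf hG h)
  simpa only [add_zero] using (ENNReal.tendsto_nat_tsum _).add hremainder

end Verification

end MarkovRuns

/-- A sequential decision problem in which a terminal reward in `[0, 1]` is collected upon stopping.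
For a multiplier `l`, the player maximizes `l` times the expected reward minus the expected number
of queries. -/
structure StoppingProblem (X A : Type*) [MeasurableSpace X] [MeasurableSpace A] where
  kernel : (n : ℕ) → Kernel (Hist X A n × A) X
  isMarkovKernel_kernel : ∀ n, IsMarkovKernel (kernel n)
  reward : Payoff X A
  measurable_reward : ∀ n, Measurable (reward n)
  reward_le_one : ∀ n z, reward n z ≤ 1

namespace StoppingProblem

attribute [instance] isMarkovKernel_kernel

noncomputable section ValueIteration

variable {X A : Type*} [MeasurableSpace X] [MeasurableSpace A] (P : StoppingProblem X A)

/-- The payoff of an action when `V` is the value to go, for the multiplier `l`. The unit cost of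
a query is refunded to all actions, so that nothing is negative: stopping pays `l * reward + 1`. -/
def lookahead (l : ℝ≥0) (V : Payoff X A) : (n : ℕ) → Hist X A n → Option A → ℝ≥0∞ :=
  actionPayoff P.kernel (fun n z => l * P.reward n z + 1) V

/-- The optimal value to go for the multiplier `l` if at most `k - 1` queries are allowed, and `0`
for `k = 0`. -/
def iterValue (l : ℝ≥0) : ℕ → Payoff X A
  | 0 => 0
  | k + 1 => fun n z => (⨆ b, P.lookahead l (iterValue l k) n z b) - 1

/-- The optimal value to go for the multiplier `l`. -/
def value (l : ℝ≥0) : Payoff X A := fun n z => ⨆ k, P.iterValue l k n z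

/-- The optimal value of an action for the multiplier `l`, with the unit cost of a query refunded
to all actions. -/
def actionValue (l : ℝ≥0) : (n : ℕ) → Hist X A n → Option A → ℝ≥0∞ :=
  P.lookahead l (P.value l)

variable {P} {l l' h : ℝ≥0} {V V' : Payoff X A} {k n : ℕ} {z : Hist X A n} {b : Option A}

theorem lookahead_mono (hl : l ≤ l') (hV : ∀ n z, V n z ≤ V' n z) :
    P.lookahead l V n z b ≤ P.lookahead l' V' n z b := by
  cases b with
  | none => exact add_le_add (by gcongr) le_rfl
  | some a => exact lintegral_mono fun x => hV _ _

theorem lookahead_add_le (hV : ∀ n z, V' n z ≤ V n z + h) :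
    P.lookahead (l + h) V' n z b ≤ P.lookahead l V n z b + h := by
  cases b with
  | none =>
    calc
      _ = l * P.reward n z + h * P.reward n z + 1 := by
        simp [lookahead, actionPayoff, add_mul]
      _ ≤ l * P.reward n z + h * 1 + 1 := by gcongr; exact P.reward_le_one n z
      _ = _ := by rw [mul_one, add_right_comm]; rfl
  | some a =>
    calc
      _ ≤ ∫⁻ x, (V (n + 1) (z.snoc a x) + h) ∂P.kernel n (z, a) :=
        lintegral_mono fun x => hV _ _
      _ = _ := by
        rw [lintegral_add_right _ measurable_const, lintegral_const, measure_univ, mul_one]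
        rfl

theorem iterValue_succ_add_one :
    P.iterValue l (k + 1) n z + 1 = ⨆ b, P.lookahead l (P.iterValue l k) n z b :=
  tsub_add_cancel_of_le (le_add_self.trans
    (le_iSup (P.lookahead l (P.iterValue l k) n z) none))

theorem iterValue_mono (hl : l ≤ l') : P.iterValue l k n z ≤ P.iterValue l' k n z := by
  induction k generalizing n with
  | zero => exact le_rfl
  | succ k ih => exact tsub_le_tsub_right (iSup_mono fun b => lookahead_mono hl fun _ _ => ih) 1

theorem iterValue_add_le : P.iterValue (l + h) k n z ≤ P.iterValue l k n z + h := by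
  induction k generalizing n with
  | zero => exact zero_le
  | succ k ih =>
    rw [← ENNReal.add_le_add_iff_right ENNReal.one_ne_top, add_right_comm, iterValue_succ_add_one,
      iterValue_succ_add_one]
    exact iSup_le fun b => (lookahead_add_le fun _ _ => ih).trans
      (add_le_add (le_iSup (P.lookahead l (P.iterValue l k) n z) b) le_rfl)

theorem monotone_iterValue (l : ℝ≥0) (n : ℕ) (z : Hist X A n) :
    Monotone fun k => P.iterValue l k n z := by
  refine monotone_nat_of_le_succ fun k => ?_
  induction k generalizing n with
  | zero => exact zero_le
  | succ k ih =>
    exact tsub_le_tsub_right (iSup_mono fun b => lookahead_mono le_rfl fun _ _ => ih _ _) 1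

theorem iterValue_zero_left : P.iterValue 0 k n z = 0 := by
  induction k generalizing n with
  | zero => rfl
  | succ k ih =>
    refine tsub_eq_zero_of_le (iSup_le fun b => ?_)
    cases b <;> simp [lookahead, actionPayoff, ih]

theorem value_mono (hl : l ≤ l') : P.value l n z ≤ P.value l' n z :=
  iSup_mono fun _ => iterValue_mono hl

theorem value_add_le : P.value (l + h) n z ≤ P.value l n z + h :=
  iSup_le fun k => iterValue_add_le.trans
    (add_le_add (le_iSup (fun k => P.iterValue l k n z) k) le_rfl)

theorem value_le : P.value l n z ≤ l := by
  have h := value_add_le (P := P) (l := 0) (h := l) (z := z)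
  simpa only [zero_add, value, iterValue_zero_left, iSup_const] using h

theorem value_ne_top : P.value l n z ≠ ⊤ :=
  ne_top_of_le_ne_top ENNReal.coe_ne_top value_le

theorem lintegral_value_ne_top {μ : Measure (Hist X A n)} [IsFiniteMeasure μ] :
    ∫⁻ z, P.value l n z ∂μ ≠ ⊤ :=
  ((lintegral_mono fun _ => value_le).trans_lt
    (lintegral_const_lt_top ENNReal.coe_ne_top)).ne

theorem actionValue_add_le : P.actionValue (l + h) n z b ≤ P.actionValue l n z b + h :=
  lookahead_add_le fun _ _ => value_add_le

theorem measurable_lookahead (hV : ∀ n, Measurable (V n)) (l : ℝ≥0) (n : ℕ) (b : Option A) :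
    Measurable fun z => P.lookahead l V n z b :=
  measurable_actionPayoff _ (fun n => ((P.measurable_reward n).const_mul _).add_const _) hV n b

section Measurability

variable [Countable A]

theorem measurable_iterValue (l : ℝ≥0) (k n : ℕ) : Measurable (P.iterValue l k n) := by
  induction k generalizing n with
  | zero => exact measurable_const
  | succ k ih => exact (Measurable.iSup (measurable_lookahead ih l n)).sub_const 1

theorem measurable_value (l : ℝ≥0) (n : ℕ) : Measurable (P.value l n) :=
  Measurable.iSup fun k => measurable_iterValue l k n

theorem measurable_actionValue (l : ℝ≥0) (n : ℕ) (b : Option A) :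
    Measurable fun z => P.actionValue l n z b :=
  measurable_lookahead (measurable_value l) l n b

theorem actionValue_eq_iSup :
    P.actionValue l n z b = ⨆ k, P.lookahead l (P.iterValue l k) n z b := by
  cases b with
  | none => exact iSup_const.symm
  | some a =>
    exact lintegral_iSup (fun k => (measurable_iterValue l k _).comp (measurable_snoc_right z a))
      fun i j hij x => monotone_iterValue l _ _ hij

theorem value_add_one : P.value l n z + 1 = ⨆ b, P.actionValue l n z b := by
  have hshift : P.value l n z = ⨆ k, P.iterValue l (k + 1) n z :=
    ((monotone_iterValue l n z).iSup_nat_add 1).symm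
  simp only [hshift, ENNReal.iSup_add, iterValue_succ_add_one, actionValue_eq_iSup]
  exact iSup_comm

theorem actionValue_le : P.actionValue l n z b ≤ P.value l n z + 1 :=
  (le_iSup (P.actionValue l n z) b).trans_eq value_add_one.symm

theorem actionValue_ne_top : P.actionValue l n z b ≠ ⊤ :=
  ne_top_of_le_ne_top (ENNReal.add_ne_top.2 ⟨value_ne_top, ENNReal.one_ne_top⟩) actionValue_le

theorem iSup_toReal_actionValue :
    ⨆ b, (P.actionValue l n z b).toReal = (P.value l n z).toReal + 1 := by
  rw [← ENNReal.toReal_iSup fun _ => actionValue_ne_top, ← value_add_one,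
    ENNReal.toReal_add value_ne_top ENNReal.one_ne_top, ENNReal.toReal_one]

end Measurability

end ValueIteration

noncomputable section Verification

variable {X A : Type*} [MeasurableSpace X] [Fintype A] [MeasurableSpace A]
  (P : StoppingProblem X A)

/-- The policy only plays actions of maximal value for the multiplier `l`. -/
def IsGreedy (l : ℝ≥0) (π : Policy X A) : Prop :=
  ∀ n z a, π.prob n z a ≠ 0 → ∀ b, P.actionValue l n z b ≤ P.actionValue l n z a

/-- The expected reward of a policy that starts at time `n` with a trajectory of law `μ`. -/
def expReward (π : Policy X A) (n : ℕ) (μ : Measure (Hist X A n)) : ℝ≥0∞ :=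
  ∫⁻ o, P.reward o.1 o.2 ∂stoppedLaw P.kernel π n μ

variable {P} {l : ℝ≥0} {π : Policy X A} {n : ℕ} {z : Hist X A n} {μ : Measure (Hist X A n)}

theorem IsGreedy.value_add_one_le (hπ : P.IsGreedy l π) :
    P.value l n z + 1 ≤ ∑ b, π.prob n z b * P.actionValue l n z b := by
  refine π.le_sum_prob_mul fun b hb => ?_
  rw [value_add_one]
  exact iSup_le (hπ n z b hb)

theorem lintegral_mul_reward :
    ∫⁻ o, l * P.reward o.1 o.2 ∂stoppedLaw P.kernel π n μ = l * P.expReward π n μ :=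
  lintegral_const_mul _ (measurable_traj P.measurable_reward)

variable [IsFiniteMeasure μ]

theorem mul_expReward_le (P : StoppingProblem X A) (l : ℝ≥0) (π : Policy X A) :
    l * P.expReward π n μ ≤ ∫⁻ z, P.value l n z ∂μ + expQueries P.kernel π n μ := by
  have h := lintegral_stoppedLaw_le (K := P.kernel) (π := π) (μ := μ) (c := 1)
    (f := fun n z => l * P.reward n z) (fun n => (P.measurable_reward n).const_mul _)
    (measurable_value l) fun n z => π.sum_prob_mul_le fun b => actionValue_le
  simpa only [lintegral_mul_reward, ENNReal.coe_one, one_mul] using h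

theorem IsGreedy.expQueries_le (hπ : P.IsGreedy l π) :
    expQueries P.kernel π n μ ≤ l * μ Set.univ := by
  have hl (n : ℕ) (z : Hist X A n) : l * P.reward n z ≤ l :=
    mul_le_of_le_one_right' (P.reward_le_one n z)
  have h := mul_expQueries_le (μ := μ) (c := 1) (fun n => (P.measurable_reward n).const_mul _)
    (measurable_value l) hl (fun _ _ => value_le) fun n z => hπ.value_add_one_le
  simpa only [ENNReal.coe_one, one_mul] using h

theorem IsGreedy.expQueries_ne_top (hπ : P.IsGreedy l π) : expQueries P.kernel π n μ ≠ ⊤ :=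
  ne_top_of_le_ne_top (ENNReal.mul_ne_top ENNReal.coe_ne_top (measure_ne_top μ _)) hπ.expQueries_le

theorem IsGreedy.mul_expReward_eq (hπ : P.IsGreedy l π) :
    l * P.expReward π n μ = ∫⁻ z, P.value l n z ∂μ + expQueries P.kernel π n μ := by
  refine (P.mul_expReward_le l π).antisymm ?_
  have h := le_lintegral_stoppedLaw (c := 1) (f := fun n z => l * P.reward n z)
    (fun n => (P.measurable_reward n).const_mul _) (measurable_value l) (fun _ _ => value_le)
    (hπ.expQueries_ne_top (μ := μ)) fun n z => hπ.value_add_one_le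
  simpa only [lintegral_mul_reward, ENNReal.coe_one, one_mul] using h

end Verification

end StoppingProblem

open Classical in
/-- The policy that plays `f n z` at the trajectory `z`. -/
noncomputable def Policy.deterministic {X A : Type*} [MeasurableSpace X] [Fintype A]
    [MeasurableSpace A] (f : (n : ℕ) → Hist X A n → Option A)
    (hf : ∀ n s, MeasurableSet (f n ⁻¹' s)) : Policy X A where
  prob n z b := if f n z = b then 1 else 0
  measurable_prob n b := Measurable.ite (hf n {b}) measurable_const measurable_const
  sum_prob n z := by simp

namespace StoppingProblem

noncomputable section Derivative

/-- The increments of the multiplier along which right derivatives are taken. -/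
def stepSize (k : ℕ) : ℝ≥0 := 1 / ((k : ℝ≥0) + 1)

theorem coe_stepSize_ne_zero (k : ℕ) : (stepSize k : ℝ≥0∞) ≠ 0 := by
  simp [stepSize]

theorem tendsto_coe_stepSize : Tendsto (fun k => (stepSize k : ℝ≥0∞)) atTop (𝓝 0) :=
  ENNReal.tendsto_coe.2 tendsto_one_div_add_atTop_nhds_zero_nat

section Slope

variable {X A : Type*} [MeasurableSpace X] [MeasurableSpace A] (P : StoppingProblem X A)
  (l : ℝ≥0)

/-- A difference quotient of the optimal value to go with respect to the multiplier. -/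
def slope (k : ℕ) : Payoff X A := fun n z =>
  (P.value (l + stepSize k) n z - P.value l n z) / stepSize k

/-- The upper right derivative of the optimal value to go with respect to the multiplier. -/
def upperDeriv : Payoff X A := fun n z => limsup (fun k => P.slope l k n z) atTop

variable {P l} {k n : ℕ} {z : Hist X A n} {b : Option A}

theorem value_add_mul_slope :
    P.value l n z + stepSize k * P.slope l k n z = P.value (l + stepSize k) n z := by
  rw [slope, ENNReal.mul_div_cancel (coe_stepSize_ne_zero k) ENNReal.coe_ne_top]
  exact add_tsub_cancel_of_le (value_mono le_self_add)

theorem slope_le_one : P.slope l k n z ≤ 1 := by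
  refine ENNReal.div_le_of_le_mul ?_
  rw [one_mul, tsub_le_iff_left]
  exact value_add_le

theorem upperDeriv_le_one : P.upperDeriv l n z ≤ 1 :=
  limsup_le_of_le (h := Eventually.of_forall fun _ => slope_le_one)

variable [Countable A]

theorem measurable_slope (l : ℝ≥0) (k n : ℕ) : Measurable (P.slope l k n) :=
  ((measurable_value _ n).sub (measurable_value _ n)).div_const _

theorem measurable_upperDeriv (l : ℝ≥0) (n : ℕ) : Measurable (P.upperDeriv l n) :=
  Measurable.limsup fun k => measurable_slope l k n

theorem actionValue_add_mul_slope :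
    P.actionValue l n z b + stepSize k * actionPayoff P.kernel P.reward (P.slope l k) n z b =
      P.actionValue (l + stepSize k) n z b := by
  cases b with
  | none => simp only [actionValue, lookahead, actionPayoff, ENNReal.coe_add]; ring
  | some a =>
    have hs := measurable_snoc_right z a
    have hslope : Measurable fun x => P.slope l k (n + 1) (z.snoc a x) :=
      (measurable_slope l k _).comp hs
    have hvalue : Measurable fun x => P.value l (n + 1) (z.snoc a x) :=
      (measurable_value l _).comp hs
    simp only [actionValue, lookahead, actionPayoff]
    rw [← lintegral_const_mul _ hslope, ← lintegral_add_left hvalue]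
    simp only [value_add_mul_slope]

theorem limsup_actionPayoff_slope_le :
    limsup (fun k => actionPayoff P.kernel P.reward (P.slope l k) n z b) atTop ≤
      actionPayoff P.kernel P.reward (P.upperDeriv l) n z b := by
  cases b with
  | none => exact (limsup_const _).le
  | some a =>
    refine limsup_lintegral_le (fun _ => 1)
      (fun k => (measurable_slope l k _).comp (measurable_snoc_right z a))
      (fun k => .of_forall fun x => slope_le_one) ?_
    simp

theorem le_lintegral_upperDeriv {μ : Measure (Hist X A n)} [IsFiniteMeasure μ] {d : ℝ≥0∞}
    (hd : ∀ h : ℝ≥0, ∫⁻ z, P.value l n z ∂μ + d * h ≤ ∫⁻ z, P.value (l + h) n z ∂μ) :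
    d ≤ ∫⁻ z, P.upperDeriv l n z ∂μ := by
  have hslope (k : ℕ) : d ≤ ∫⁻ z, P.slope l k n z ∂μ := by
    have h := hd (stepSize k)
    simp only [← value_add_mul_slope] at h
    rw [lintegral_add_left (measurable_value l n), lintegral_const_mul _ (measurable_slope l k n),
      ENNReal.add_le_add_iff_left lintegral_value_ne_top, mul_comm] at h
    exact (ENNReal.mul_le_mul_iff_right (coe_stepSize_ne_zero k) ENNReal.coe_ne_top).1 h
  calc
    d = limsup (fun _ => d) atTop := (limsup_const d).symm
    _ ≤ limsup (fun k => ∫⁻ z, P.slope l k n z ∂μ) atTop := limsup_le_limsup (.of_forall hslope)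
    _ ≤ ∫⁻ z, P.upperDeriv l n z ∂μ :=
      limsup_lintegral_le (fun _ => 1) (fun k => measurable_slope l k n)
        (fun k => .of_forall fun _ => slope_le_one) (by simp)

end Slope

section OptimalActions

variable {X A : Type*} [MeasurableSpace X] [Fintype A] [MeasurableSpace A]
  (P : StoppingProblem X A) (l : ℝ≥0)

open Classical in
/-- The actions of maximal value for the multiplier `l`. -/
def optimalActions (n : ℕ) (z : Hist X A n) : Finset (Option A) :=
  {b | P.actionValue l n z b = P.value l n z + 1}

variable {P l} {n : ℕ} {z : Hist X A n} {b : Option A}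

theorem mem_optimalActions :
    b ∈ P.optimalActions l n z ↔ P.actionValue l n z b = P.value l n z + 1 := by
  simp [optimalActions]

theorem optimalActions_nonempty : (P.optimalActions l n z).Nonempty := by
  obtain ⟨b, hb⟩ := exists_eq_ciSup_of_finite (f := P.actionValue l n z)
  exact ⟨b, mem_optimalActions.2 (hb.trans value_add_one.symm)⟩

theorem eventually_optimalActions_subset (P : StoppingProblem X A) (l : ℝ≥0)
    (z : Hist X A n) :
    ∀ᶠ k in atTop, P.optimalActions (l + stepSize k) n z ⊆ P.optimalActions l n z := by
  have hgap : ∀ᶠ k in atTop, ∀ b ∉ P.optimalActions l n z,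
      P.actionValue l n z b + stepSize k < P.value l n z + 1 := by
    refine eventually_all.2 fun b => eventually_imp_distrib_left.2 fun hb => ?_
    refine (tendsto_const_nhds.add tendsto_coe_stepSize).eventually_lt_const ?_
    rw [add_zero]
    exact lt_of_le_of_ne actionValue_le (mt mem_optimalActions.2 hb)
  filter_upwards [hgap] with k hk b hb
  by_contra hbl
  refine (hk b hbl).not_ge ?_
  calc
    P.value l n z + 1 ≤ P.value (l + stepSize k) n z + 1 :=
      add_le_add (value_mono le_self_add) le_rfl
    _ = P.actionValue (l + stepSize k) n z b := (mem_optimalActions.1 hb).symm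
    _ ≤ P.actionValue l n z b + stepSize k := actionValue_add_le

theorem slope_eq_actionPayoff {k : ℕ} (hb : b ∈ P.optimalActions l n z)
    (hbk : b ∈ P.optimalActions (l + stepSize k) n z) :
    P.slope l k n z = actionPayoff P.kernel P.reward (P.slope l k) n z b := by
  rw [mem_optimalActions, ← actionValue_add_mul_slope, ← value_add_mul_slope,
    mem_optimalActions.1 hb, add_right_comm _ (stepSize k * P.slope l k n z)] at hbk
  have hfin : P.value l n z + 1 ≠ ⊤ :=
    ENNReal.add_ne_top.2 ⟨value_ne_top, ENNReal.one_ne_top⟩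
  exact ((ENNReal.mul_right_inj (coe_stepSize_ne_zero k) ENNReal.coe_ne_top).1
    ((ENNReal.add_right_inj hfin).1 hbk)).symm

theorem exists_mem_optimalActions_upperDeriv_le (P : StoppingProblem X A) (l : ℝ≥0)
    (z : Hist X A n) :
    ∃ b ∈ P.optimalActions l n z,
      P.upperDeriv l n z ≤ actionPayoff P.kernel P.reward (P.upperDeriv l) n z b := by
  obtain ⟨b, hb, hmax⟩ := Finset.exists_mem_eq_sup _ (optimalActions_nonempty (P := P))
    (actionPayoff P.kernel P.reward (P.upperDeriv l) n z)
  refine ⟨b, hb, ?_⟩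
  have hslope : ∀ᶠ k in atTop, P.slope l k n z ≤
      (P.optimalActions l n z).sup (actionPayoff P.kernel P.reward (P.slope l k) n z) := by
    filter_upwards [eventually_optimalActions_subset P l z] with k hk
    obtain ⟨c, hc⟩ := optimalActions_nonempty (P := P) (l := l + stepSize k) (z := z)
    rw [slope_eq_actionPayoff (hk hc) hc]
    exact Finset.le_sup (hk hc)
  calc
    P.upperDeriv l n z ≤ limsup (fun k => (P.optimalActions l n z).sup
        (actionPayoff P.kernel P.reward (P.slope l k) n z)) atTop := limsup_le_limsup hslope
    _ = (P.optimalActions l n z).sup fun b =>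
        limsup (fun k => actionPayoff P.kernel P.reward (P.slope l k) n z b) atTop :=
      limsup_finset_sup
    _ ≤ (P.optimalActions l n z).sup (actionPayoff P.kernel P.reward (P.upperDeriv l) n z) :=
      Finset.sup_mono_fun fun b _ => limsup_actionPayoff_slope_le
    _ = _ := hmax

theorem exists_isGreedy_upperDeriv_le (P : StoppingProblem X A) (l : ℝ≥0) :
    ∃ π : Policy X A, (∀ n z, ∃ a, π.prob n z a = 1) ∧ P.IsGreedy l π ∧
      ∀ n z b, π.prob n z b ≠ 0 →
        P.upperDeriv l n z ≤ actionPayoff P.kernel P.reward (P.upperDeriv l) n z b := by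
  have hsel (n : ℕ) := exists_measurable_selection
    (exists_mem_optimalActions_upperDeriv_le (n := n) P l) fun b => by
      simp only [mem_optimalActions]
      exact (measurableSet_eq_fun (measurable_actionValue l n b)
        ((measurable_value l n).add_const 1)).inter (measurableSet_le (measurable_upperDeriv l n)
          (measurable_actionPayoff _ P.measurable_reward (measurable_upperDeriv l) n b))
  choose f hf hopt hder using hsel
  have hsupp {n : ℕ} {z : Hist X A n} {b : Option A}
      (hb : (Policy.deterministic f hf).prob n z b ≠ 0) : f n z = b :=
    of_not_not fun hne => hb (if_neg hne)
  refine ⟨.deterministic f hf, fun n z => ⟨f n z, if_pos rfl⟩, fun n z b hb c => ?_,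
    fun n z b hb => ?_⟩
  · rw [← hsupp hb, mem_optimalActions.1 (hopt n z)]
    exact actionValue_le
  · rw [← hsupp hb]
    exact hder n z

variable {μ : Measure (Hist X A n)} [IsFiniteMeasure μ]

theorem IsGreedy.lintegral_upperDeriv_le {π : Policy X A} (hπ : P.IsGreedy l π)
    (hder : ∀ n z b, π.prob n z b ≠ 0 →
      P.upperDeriv l n z ≤ actionPayoff P.kernel P.reward (P.upperDeriv l) n z b) :
    ∫⁻ z, P.upperDeriv l n z ∂μ ≤ P.expReward π n μ := by
  have h := le_lintegral_stoppedLaw (c := 0) (C := 1) P.measurable_reward (measurable_upperDeriv l)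
    (fun _ _ => upperDeriv_le_one) (hπ.expQueries_ne_top (μ := μ)) fun n z => by
      simpa only [ENNReal.coe_zero, add_zero] using π.le_sum_prob_mul (hder n z)
  simpa only [ENNReal.coe_zero, zero_mul, add_zero, expReward] using h

theorem exists_isGreedy_le_expReward {d : ℝ≥0∞}
    (hd : ∀ h : ℝ≥0, ∫⁻ z, P.value l n z ∂μ + d * h ≤ ∫⁻ z, P.value (l + h) n z ∂μ) :
    ∃ π : Policy X A, P.IsGreedy l π ∧ d ≤ P.expReward π n μ := by
  obtain ⟨π, -, hπ, hder⟩ := P.exists_isGreedy_upperDeriv_le l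
  exact ⟨π, hπ, (le_lintegral_upperDeriv hd).trans (hπ.lintegral_upperDeriv_le hder)⟩

end OptimalActions

end Derivative

end StoppingProblem

noncomputable section ChangeOfMeasure

section Mixtures

variable {α β : Type*} [MeasurableSpace α] [MeasurableSpace β]

theorem map_withDensity_comp {μ : Measure α} {f : α → β} (hf : Measurable f) {g : β → ℝ≥0∞}
    (hg : Measurable g) : (μ.withDensity (g ∘ f)).map f = (μ.map f).withDensity g := by
  ext s hs
  rw [Measure.map_apply hf hs, withDensity_apply _ (hf hs), withDensity_apply _ hs,
    setLIntegral_map hs hg hf]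
  rfl

theorem withDensity_bind {μ : Measure α} {g : α → ℝ≥0∞} (hg : Measurable g) (κ : Kernel α β) :
    (μ.withDensity g).bind κ = μ.bind fun a => g a • κ a := by
  have hm : Measurable fun a => g a • κ a :=
    Measure.measurable_of_measurable_coe _ fun s hs => hg.mul (κ.measurable_coe hs)
  ext s hs
  rw [Measure.bind_apply hs κ.aemeasurable, Measure.bind_apply hs hm.aemeasurable]
  exact lintegral_withDensity_eq_lintegral_mul _ hg (κ.measurable_coe hs)

variable {μ : Measure α} {ν : Measure β} [SFinite ν] {g : α → β → ℝ≥0∞}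

theorem bind_withDensity [SFinite μ] (hg : Measurable (Function.uncurry g)) :
    μ.bind (fun a => ν.withDensity (g a)) = ν.withDensity fun b => ∫⁻ a, g a b ∂μ := by
  have hm : Measurable fun a => ν.withDensity (g a) := by
    refine Measure.measurable_of_measurable_coe _ fun s hs => ?_
    simp only [withDensity_apply _ hs]
    exact hg.lintegral_prod_right'
  ext s hs
  rw [Measure.bind_apply hs hm.aemeasurable, withDensity_apply _ hs]
  simp only [withDensity_apply _ hs]
  exact lintegral_lintegral_swap hg.aemeasurable

theorem ae_lintegral_ne_top [IsFiniteMeasure μ] (hg : Measurable (Function.uncurry g)) {C : ℝ≥0}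
    (hC : ∀ a, ∫⁻ b, g a b ∂ν ≤ C) : ∀ᵐ b ∂ν, ∫⁻ a, g a b ∂μ ≠ ⊤ := by
  have hfin : ∫⁻ b, ∫⁻ a, g a b ∂μ ∂ν ≠ ⊤ := by
    rw [← lintegral_lintegral_swap hg.aemeasurable]
    exact ne_top_of_le_ne_top (ENNReal.mul_ne_top ENNReal.coe_ne_top (measure_ne_top μ Set.univ))
      ((lintegral_mono hC).trans_eq (lintegral_const _))
  exact (ae_lt_top hg.lintegral_prod_left' hfin).mono fun _ => ne_of_lt

theorem bind_dirac_prod_withDensity (hg : Measurable (Function.uncurry g)) :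
    (μ.bind fun a => (Measure.dirac a).prod (ν.withDensity (g a))) =
      (μ.prod ν).withDensity (Function.uncurry g) := by
  have happly {s : Set (α × β)} (hs : MeasurableSet s) (a : α) :
      (Measure.dirac a).prod (ν.withDensity (g a)) s =
        ∫⁻ b, s.indicator (Function.uncurry g) (a, b) ∂ν := by
    rw [Measure.dirac_prod, Measure.map_apply measurable_prodMk_left hs,
      withDensity_apply _ (measurable_prodMk_left hs),
      ← lintegral_indicator (measurable_prodMk_left hs)]
    rfl
  have hm : Measurable fun a => (Measure.dirac a).prod (ν.withDensity (g a)) := by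
    refine Measure.measurable_of_measurable_coe _ fun s hs => ?_
    simp only [happly hs]
    exact (hg.indicator hs).lintegral_prod_right'
  ext s hs
  rw [Measure.bind_apply hs hm.aemeasurable, withDensity_apply _ hs, ← lintegral_indicator hs,
    lintegral_prod _ (hg.indicator hs).aemeasurable]
  exact lintegral_congr fun a => happly hs a

end Mixtures

variable {X A : Type*} [MeasurableSpace X] [Fintype A] [MeasurableSpace A]
  {K K₀ : (n : ℕ) → Kernel (Hist X A n × A) X} [∀ n, IsSFiniteKernel (K n)]
  [∀ n, IsSFiniteKernel (K₀ n)] {π : Policy X A} {n : ℕ} {ν : Measure (Hist X A n)} [SFinite ν]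
  {L : Payoff X A}

theorem runLaw_withDensity (hL : ∀ n, Measurable (L n))
    (hK : ∀ k, ∀ᵐ z ∂runLaw K₀ π n ν k, ∀ a, L (n + k) z • K (n + k) (z, a) =
      (K₀ (n + k) (z, a)).withDensity fun x => L (n + k + 1) (z.snoc a x)) (k : ℕ) :
    runLaw K π n (ν.withDensity (L n)) k = (runLaw K₀ π n ν k).withDensity (L (n + k)) := by
  induction k with
  | zero => rfl
  | succ k ih =>
    refine Measure.ext_of_lintegral _ fun f hf => ?_
    have hstep (a : A) (z : Hist X A (n + k)) (hz : L (n + k) z • K (n + k) (z, a) =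
        (K₀ (n + k) (z, a)).withDensity fun x => L (n + k + 1) (z.snoc a x)) :
        L (n + k) z * ∫⁻ x, f (z.snoc a x) ∂K (n + k) (z, a) =
          ∫⁻ x, L (n + k + 1) (z.snoc a x) * f (z.snoc a x) ∂K₀ (n + k) (z, a) := by
      rw [← smul_eq_mul, ← lintegral_smul_measure, hz]
      exact lintegral_withDensity_eq_lintegral_mul _ ((hL _).comp (measurable_snoc_right z a))
        (hf.comp (measurable_snoc_right z a))
    refine Eq.trans ?_ (lintegral_withDensity_eq_lintegral_mul _ (hL _) hf).symm
    refine (lintegral_runLaw_succ K π _ k hf).trans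
      (Eq.trans ?_ (lintegral_runLaw_succ K₀ π ν k ((hL _).mul hf)).symm)
    refine Finset.sum_congr rfl fun a _ => ?_
    rw [ih]
    refine (lintegral_withDensity_eq_lintegral_mul _ (hL _)
      ((π.measurable_prob _ _).mul (measurable_lintegral_snoc K hf a))).trans ?_
    refine lintegral_congr_ae ((hK k).mono fun z hz => ?_)
    exact (mul_left_comm _ _ _).trans (congrArg _ (hstep a z (hz a)))

theorem stoppedLaw_withDensity (hL : ∀ n, Measurable (L n))
    (hK : ∀ k, ∀ᵐ z ∂runLaw K₀ π n ν k, ∀ a, L (n + k) z • K (n + k) (z, a) =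
      (K₀ (n + k) (z, a)).withDensity fun x => L (n + k + 1) (z.snoc a x)) :
    stoppedLaw K π n (ν.withDensity (L n)) =
      (stoppedLaw K₀ π n ν).withDensity fun o => L o.1 o.2 := by
  have hround (k : ℕ) :
      (((runLaw K₀ π n ν k).withDensity (L (n + k))).withDensity fun z =>
          π.prob (n + k) z none).map (fun z => (⟨n + k, z⟩ : Traj X A)) =
        (((runLaw K₀ π n ν k).withDensity fun z => π.prob (n + k) z none).map fun z =>
          (⟨n + k, z⟩ : Traj X A)).withDensity fun o => L o.1 o.2 := by
    rw [← map_withDensity_comp (measurable_trajMk _) (measurable_traj hL),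
      ← withDensity_mul _ (hL _) (π.measurable_prob _ _), mul_comm,
      withDensity_mul _ (π.measurable_prob _ _) (hL _)]
    rfl
  simp only [stoppedLaw, withDensity_sum, runLaw_withDensity hL hK, hround]

end ChangeOfMeasure

noncomputable section Bayes

/-- The trajectory that consists of the first observation only. -/
def Hist.single {X A : Type*} (x : X) : Hist X A 0 := (x, Fin.elim0)

theorem measurable_single {X A : Type*} [MeasurableSpace X] [MeasurableSpace A] :
    Measurable (Hist.single : X → Hist X A 0) :=
  measurable_id.prodMk measurable_const

attribute [instance] Model.isProbabilityMeasure_prior Model.isMarkovKernel_init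
  Model.isMarkovKernel_trans Model.Domination.isProbabilityMeasure_base₀
  Model.Domination.isProbabilityMeasure_base

namespace Model.Domination

variable {Ω X A 𝓗 : Type*} [MetricSpace Ω] [MeasurableSpace Ω] [MetricSpace X]
  [MeasurableSpace X] [TopologicalSpace A] [MeasurableSpace A] [MeasurableSpace 𝓗]
  {M : Model Ω X A 𝓗} (D : M.Domination) {n : ℕ} (ω : Ω) (z : Hist X A n) (a : A)

theorem likelihood_snoc (x : X) :
    D.likelihood (n + 1) ω (z.snoc a x) = D.likelihood n ω z * D.dens n (ω, z, a) x := by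
  rw [likelihood, Hist.init_snoc, Hist.snoc_last]

theorem likelihood_smul_trans :
    D.likelihood n ω z • M.trans n (ω, z, a) =
      D.base.withDensity fun x => D.likelihood (n + 1) ω (z.snoc a x) := by
  have hdens : Measurable (D.dens n (ω, z, a)) :=
    (D.measurable_dens n).comp measurable_prodMk_left
  rw [D.trans_eq, ← withDensity_smul _ hdens]
  exact congrArg _ (funext fun x => (D.likelihood_snoc ω z a x).symm)

end Model.Domination

variable {Ω X A 𝓗 : Type*} [MetricSpace Ω] [CompactSpace Ω] [MeasurableSpace Ω] [BorelSpace Ω]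
  [MetricSpace X] [CompactSpace X] [MeasurableSpace X] [BorelSpace X]
  [Fintype A] [TopologicalSpace A] [DiscreteTopology A] [MeasurableSpace A]
  [DiscreteMeasurableSpace A]
  [Fintype 𝓗] [MeasurableSpace 𝓗] [DiscreteMeasurableSpace 𝓗] {M : Model Ω X A 𝓗}

/-- The law of the first observation, averaged over the prior. -/
def Model.initLaw (M : Model Ω X A 𝓗) : Measure (Hist X A 0) :=
  (M.prior.bind M.init).map Hist.single

namespace Model.Domination

section Likelihood

variable (D : M.Domination) {n : ℕ}

theorem measurable_likelihood_left (z : Hist X A n) : Measurable fun ω => D.likelihood n ω z :=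
  (D.measurable_likelihood n).comp measurable_prodMk_left

theorem measurable_likelihood_right (n : ℕ) (ω : Ω) : Measurable (D.likelihood n ω) :=
  (D.measurable_likelihood n).comp measurable_prodMk_right

theorem measurable_evidence (n : ℕ) : Measurable (D.evidence n) :=
  (D.measurable_likelihood n).lintegral_prod_right'

theorem map_init (ω : Ω) :
    (M.init ω).map Hist.single = (D.base₀.map Hist.single).withDensity (D.likelihood 0 ω) := by
  rw [← map_withDensity_comp measurable_single (D.measurable_likelihood_right 0 ω), D.init_eq]
  rfl

end Likelihood

section Posterior

variable (D : M.Domination) (n : ℕ)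

instance isMarkovKernel_posterior : IsMarkovKernel (D.posterior n) := by
  refine ⟨fun z => ?_⟩
  change IsProbabilityMeasure (ite _ _ _)
  split_ifs with h
  · infer_instance
  · push Not at h
    refine ⟨?_⟩
    rw [Measure.smul_apply, withDensity_apply _ MeasurableSet.univ, Measure.restrict_univ]
    exact ENNReal.inv_mul_cancel h.1 h.2

instance isMarkovKernel_predictive : IsMarkovKernel (D.predictive n) := by
  unfold predictive
  infer_instance

variable {n} {z : Hist X A n}

theorem evidence_smul_posterior (hz : D.evidence n z ≠ ⊤) :
    D.evidence n z • D.posterior n z = M.prior.withDensity fun ω => D.likelihood n ω z := by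
  by_cases h0 : D.evidence n z = 0
  · rw [h0, zero_smul, eq_comm,
      withDensity_eq_zero_iff (D.measurable_likelihood_left z).aemeasurable]
    exact (lintegral_eq_zero_iff (D.measurable_likelihood_left z)).1 h0
  · have hpost : D.posterior n z =
        (D.evidence n z)⁻¹ • M.prior.withDensity fun ω => D.likelihood n ω z :=
      if_neg (by simp [h0, hz])
    rw [hpost, smul_smul, ENNReal.mul_inv_cancel h0 hz, one_smul]

theorem predictive_apply (z : Hist X A n) (a : A) :
    D.predictive n (z, a) = (D.posterior n z).bind ((M.trans n).sectL (z, a)) := by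
  refine Measure.ext_of_lintegral _ fun f hf => ?_
  rw [predictive, Kernel.lintegral_comp _ _ _ hf, Kernel.lintegral_prod _ _ _ hf.lintegral_kernel,
    Measure.lintegral_bind (Kernel.measurable _).aemeasurable hf.aemeasurable]
  exact lintegral_congr fun ω =>
    lintegral_dirac' _ (hf.lintegral_kernel.comp measurable_prodMk_left)

theorem evidence_smul_predictive (hz : D.evidence n z ≠ ⊤) (a : A) :
    D.evidence n z • D.predictive n (z, a) =
      D.base.withDensity fun x => D.evidence (n + 1) (z.snoc a x) := by
  have hm : Measurable (Function.uncurry fun ω x => D.likelihood (n + 1) ω (z.snoc a x)) :=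
    (D.measurable_likelihood (n + 1)).comp
      (((measurable_snoc_right z a).comp measurable_snd).prodMk measurable_fst)
  calc
    _ = (M.prior.withDensity fun ω => D.likelihood n ω z).bind ((M.trans n).sectL (z, a)) := by
      rw [D.predictive_apply, ← Measure.comp_smul, D.evidence_smul_posterior hz]
    _ = M.prior.bind fun ω => D.base.withDensity fun x => D.likelihood (n + 1) ω (z.snoc a x) := by
      rw [withDensity_bind (D.measurable_likelihood_left z)]
      simp only [Kernel.sectL_apply, D.likelihood_smul_trans]
    _ = _ := bind_withDensity hm

end Posterior

variable (D : M.Domination) (π : Policy X A)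

/-- The law of `D_τ` when all observations are drawn from the dominating measures. -/
def baseLaw : Measure (Traj X A) :=
  stoppedLaw (fun _ => Kernel.const _ D.base) π 0 (D.base₀.map Hist.single)

/-- The law of `D_τ`, averaged over the prior. -/
def trajLaw : Measure (Traj X A) :=
  stoppedLaw D.predictive π 0 M.initLaw

instance sFinite_baseLaw : SFinite (D.baseLaw π) := by
  unfold baseLaw
  infer_instance

instance isProbabilityMeasure_initLaw : IsProbabilityMeasure M.initLaw :=
  Measure.isProbabilityMeasure_map measurable_single.aemeasurable

theorem initLaw_eq : M.initLaw = (D.base₀.map Hist.single).withDensity (D.evidence 0) := by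
  have hbind : M.initLaw = M.prior.bind fun ω => (M.init ω).map Hist.single := by
    have hmap : Measurable fun ω => (M.init ω).map (Hist.single : X → Hist X A 0) :=
      (Measure.measurable_map _ measurable_single).comp M.init.measurable
    ext s hs
    rw [initLaw, Measure.map_apply measurable_single hs,
      Measure.bind_apply (measurable_single hs) M.init.aemeasurable,
      Measure.bind_apply hs hmap.aemeasurable]
    simp only [Measure.map_apply measurable_single hs]
  rw [hbind]
  simp only [D.map_init]
  exact bind_withDensity ((D.measurable_likelihood 0).comp measurable_swap)

theorem runLaw_trans (ω : Ω) (k : ℕ) :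
    runLaw (fun n => (M.trans n).sectR ω) π 0 ((M.init ω).map Hist.single) k =
      (runLaw (fun _ => Kernel.const _ D.base) π 0 (D.base₀.map Hist.single) k).withDensity
        (D.likelihood (0 + k) ω) := by
  rw [D.map_init]
  exact runLaw_withDensity (L := fun n => D.likelihood n ω)
    (fun n => D.measurable_likelihood_right n ω)
    (fun _ => ae_of_all _ fun z a => D.likelihood_smul_trans ω z a) k

theorem stoppedLaw_trans (ω : Ω) :
    stoppedLaw (fun n => (M.trans n).sectR ω) π 0 ((M.init ω).map Hist.single) =
      (D.baseLaw π).withDensity fun t => D.likelihood t.1 ω t.2 := by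
  rw [D.map_init]
  exact stoppedLaw_withDensity (L := fun n => D.likelihood n ω)
    (fun n => D.measurable_likelihood_right n ω)
    (fun _ => ae_of_all _ fun z a => D.likelihood_smul_trans ω z a)

theorem measurable_likelihood_traj :
    Measurable (Function.uncurry fun (ω : Ω) (t : Traj X A) => D.likelihood t.1 ω t.2) :=
  measurable_prod_traj fun n => (D.measurable_likelihood n).comp measurable_swap

theorem ae_runLaw_evidence_ne_top (k : ℕ) :
    ∀ᵐ z ∂runLaw (fun _ => Kernel.const _ D.base) π 0 (D.base₀.map Hist.single) k,
      D.evidence (0 + k) z ≠ ⊤ := by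
  refine ae_lintegral_ne_top (C := 1) ((D.measurable_likelihood _).comp measurable_swap)
    fun ω => ?_
  rw [← setLIntegral_univ, ← withDensity_apply _ MeasurableSet.univ, ← D.runLaw_trans]
  have : IsProbabilityMeasure ((M.init ω).map (Hist.single : X → Hist X A 0)) :=
    Measure.isProbabilityMeasure_map measurable_single.aemeasurable
  exact (antitone_runLaw_univ k.zero_le).trans
    (prob_le_one (μ := (M.init ω).map (Hist.single : X → Hist X A 0)))

theorem ae_baseLaw_evidence_ne_top : ∀ᵐ t ∂D.baseLaw π, D.evidence t.1 t.2 ≠ ⊤ := by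
  refine ae_lintegral_ne_top (C := 1) D.measurable_likelihood_traj fun ω => ?_
  rw [← setLIntegral_univ, ← withDensity_apply _ MeasurableSet.univ, ← D.stoppedLaw_trans]
  have : IsProbabilityMeasure ((M.init ω).map (Hist.single : X → Hist X A 0)) :=
    Measure.isProbabilityMeasure_map measurable_single.aemeasurable
  exact stoppedLaw_univ_le.trans prob_le_one

theorem trajLaw_eq : D.trajLaw π = (D.baseLaw π).withDensity fun t => D.evidence t.1 t.2 := by
  rw [trajLaw, D.initLaw_eq]
  exact stoppedLaw_withDensity D.measurable_evidence fun k =>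
    (D.ae_runLaw_evidence_ne_top π k).mono fun z hz a => D.evidence_smul_predictive hz a

theorem pathLaw_eq : M.pathLaw π =
    (M.prior.prod (D.baseLaw π)).withDensity
      (Function.uncurry fun ω t => D.likelihood t.1 ω t.2) := by
  rw [← bind_dirac_prod_withDensity D.measurable_likelihood_traj]
  simp only [← D.stoppedLaw_trans]
  rfl

theorem lintegral_pathLaw {f : Ω × Traj X A → ℝ≥0∞} (hf : Measurable f) :
    ∫⁻ p, f p ∂M.pathLaw π =
      ∫⁻ t, ∫⁻ ω, f (ω, t) ∂D.posterior t.1 t.2 ∂D.trajLaw π := by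
  have hpost : Measurable fun t : Traj X A => ∫⁻ ω, f (ω, t) ∂D.posterior t.1 t.2 :=
    measurable_traj fun n => Measurable.lintegral_kernel_prod_right (κ := D.posterior n)
      (f := fun z ω => f (ω, ⟨n, z⟩))
      (hf.comp (measurable_snd.prodMk ((measurable_trajMk n).comp measurable_fst)))
  have hlik : Measurable fun p : Ω × Traj X A => D.likelihood p.2.1 p.1 p.2.2 * f p :=
    Measurable.mul (f := fun p : Ω × Traj X A => D.likelihood p.2.1 p.1 p.2.2)
      D.measurable_likelihood_traj hf
  have hbayes (t : Traj X A) (ht : D.evidence t.1 t.2 ≠ ⊤) :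
      ∫⁻ ω, D.likelihood t.1 ω t.2 * f (ω, t) ∂M.prior =
        D.evidence t.1 t.2 * ∫⁻ ω, f (ω, t) ∂D.posterior t.1 t.2 := by
    rw [← smul_eq_mul, ← lintegral_smul_measure, D.evidence_smul_posterior ht]
    exact (lintegral_withDensity_eq_lintegral_mul _ (D.measurable_likelihood_left _)
      (hf.comp measurable_prodMk_right)).symm
  calc
    _ = ∫⁻ p, D.likelihood p.2.1 p.1 p.2.2 * f p ∂M.prior.prod (D.baseLaw π) := by
      rw [D.pathLaw_eq]
      exact lintegral_withDensity_eq_lintegral_mul _ D.measurable_likelihood_traj hf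
    _ = ∫⁻ t, ∫⁻ ω, D.likelihood t.1 ω t.2 * f (ω, t) ∂M.prior ∂D.baseLaw π :=
      lintegral_prod_symm _ hlik.aemeasurable
    _ = ∫⁻ t, D.evidence t.1 t.2 * ∫⁻ ω, f (ω, t) ∂D.posterior t.1 t.2 ∂D.baseLaw π :=
      lintegral_congr_ae ((D.ae_baseLaw_evidence_ne_top π).mono hbayes)
    _ = _ := by
      rw [D.trajLaw_eq]
      exact (lintegral_withDensity_eq_lintegral_mul _ (measurable_traj D.measurable_evidence)
        hpost).symm

end Model.Domination

end Bayes

theorem neg_coe_add_coe {E : ℝ≥0∞} (hE : E ≠ ⊤) (x : ℝ) :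
    -(E : EReal) + (x : EReal) = ((x - E.toReal : ℝ) : EReal) := by
  rw [← EReal.coe_ennreal_toReal hE, ← EReal.coe_neg, ← EReal.coe_add, neg_add_eq_sub]

namespace StoppingProblem

noncomputable section MeanValue

variable {X A : Type*} [MeasurableSpace X] [MeasurableSpace A] (P : StoppingProblem X A)

/-- The mean of the optimal value when the trajectory at time `n` has law `μ`. -/
def meanValue (l : ℝ≥0) (n : ℕ) (μ : Measure (Hist X A n)) : ℝ :=
  (∫⁻ z, P.value l n z ∂μ).toReal

theorem lipschitzWith_meanValue (n : ℕ) (μ : Measure (Hist X A n))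
    [IsProbabilityMeasure μ] : LipschitzWith 1 fun l => P.meanValue l n μ := by
  refine LipschitzWith.of_le_add fun x y => ?_
  rw [← coe_nndist, meanValue, meanValue, ← ENNReal.coe_toReal,
    ← ENNReal.toReal_add lintegral_value_ne_top ENNReal.coe_ne_top]
  refine ENNReal.toReal_mono
    (ENNReal.add_ne_top.2 ⟨lintegral_value_ne_top, ENNReal.coe_ne_top⟩) ?_
  have hxy : x ≤ y + nndist x y := by
    rw [← NNReal.coe_le_coe, NNReal.coe_add, coe_nndist, NNReal.dist_eq]
    linarith [le_abs_self ((x : ℝ) - y)]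
  calc
    _ ≤ ∫⁻ z, (P.value y n z + nndist x y) ∂μ :=
      lintegral_mono fun z => (value_mono hxy).trans value_add_le
    _ = _ := by
      rw [lintegral_add_right _ measurable_const, lintegral_const, measure_univ, mul_one]

theorem meanValue_dirac [Countable A] (l : ℝ≥0) {n : ℕ} (z : Hist X A n) :
    P.meanValue l n (Measure.dirac z) = (P.value l n z).toReal := by
  rw [meanValue, lintegral_dirac' _ (measurable_value l n)]

end MeanValue

noncomputable section RealValued

variable {X A : Type*} [MeasurableSpace X] [Fintype A] [MeasurableSpace A]
  (P : StoppingProblem X A) {l : ℝ≥0} {n : ℕ} {π : Policy X A}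
  {μ : Measure (Hist X A n)}

/-- The expected reward times `l` minus the expected number of queries, for a policy that starts at
time `n` with a trajectory of law `μ`. -/
def netPayoff (l : ℝ≥0) (π : Policy X A) (n : ℕ) (μ : Measure (Hist X A n)) : EReal :=
  -(expQueries P.kernel π n μ : EReal) + ((l * (P.expReward π n μ).toReal : ℝ) : EReal)

variable {P} [IsFiniteMeasure μ]

theorem expReward_ne_top : P.expReward π n μ ≠ ⊤ :=
  ((lintegral_mono fun o : Traj X A => P.reward_le_one o.1 o.2).trans_lt <| by
    rw [lintegral_one]
    exact stoppedLaw_univ_le.trans_lt (measure_lt_top μ _)).ne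

theorem netPayoff_le : P.netPayoff l π n μ ≤ P.meanValue l n μ := by
  by_cases hE : expQueries P.kernel π n μ = ⊤
  · simp [netPayoff, hE]
  rw [netPayoff, neg_coe_add_coe hE, EReal.coe_le_coe_iff, sub_le_iff_le_add, meanValue,
    ← ENNReal.toReal_add lintegral_value_ne_top hE, ← ENNReal.coe_toReal, ← ENNReal.toReal_mul]
  exact ENNReal.toReal_mono (ENNReal.add_ne_top.2 ⟨lintegral_value_ne_top, hE⟩)
    (P.mul_expReward_le l π)

theorem IsGreedy.netPayoff_eq (hπ : P.IsGreedy l π) : P.netPayoff l π n μ = P.meanValue l n μ := by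
  have hE := hπ.expQueries_ne_top (μ := μ)
  rw [netPayoff, neg_coe_add_coe hE, EReal.coe_eq_coe_iff, sub_eq_iff_eq_add, meanValue,
    ← ENNReal.toReal_add lintegral_value_ne_top hE, ← ENNReal.coe_toReal, ← ENNReal.toReal_mul,
    hπ.mul_expReward_eq]

theorem iSup_netPayoff : ⨆ π, P.netPayoff l π n μ = P.meanValue l n μ := by
  obtain ⟨π, -, hπ, -⟩ := P.exists_isGreedy_upperDeriv_le l
  exact (iSup_le fun _ => netPayoff_le).antisymm
    (hπ.netPayoff_eq.symm.trans_le (le_iSup (P.netPayoff l · n μ) π))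

end RealValued

end StoppingProblem

noncomputable section Application

variable {Ω X A 𝓗 : Type*} [MetricSpace Ω] [CompactSpace Ω] [MeasurableSpace Ω] [BorelSpace Ω]
  [MetricSpace X] [CompactSpace X] [MeasurableSpace X] [BorelSpace X]
  [Fintype A] [TopologicalSpace A] [DiscreteTopology A] [MeasurableSpace A]
  [DiscreteMeasurableSpace A]
  [Fintype 𝓗] [MeasurableSpace 𝓗] [DiscreteMeasurableSpace 𝓗] {M : Model Ω X A 𝓗}

namespace Model.Domination

section Problem

variable (D : M.Domination)

/-- The decision problem of a Bayesian player, whose reward is the maximal posterior probability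
of a hypothesis. -/
def problem : StoppingProblem X A where
  kernel := D.predictive
  isMarkovKernel_kernel := D.isMarkovKernel_predictive
  reward n z := ⨆ H : 𝓗, D.posterior n z (M.truth ⁻¹' {H})
  measurable_reward _ := Measurable.iSup fun H =>
    Kernel.measurable_coe _ (M.measurable_truth (measurableSet_singleton H))
  reward_le_one _ _ := iSup_le fun _ => prob_le_one

theorem toReal_reward (n : ℕ) (z : Hist X A n) :
    (D.problem.reward n z).toReal = D.maxPosterior n z :=
  ENNReal.toReal_iSup fun _ => measure_ne_top _ _

theorem posterior_le_reward {n : ℕ} (z : Hist X A n) (H : 𝓗) :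
    D.posterior n z (M.truth ⁻¹' {H}) ≤ D.problem.reward n z :=
  le_iSup (fun H => D.posterior n z (M.truth ⁻¹' {H})) H

theorem integral_maxPosterior {β : Type*} [MeasurableSpace β] (ν : Measure β) {g : β → Traj X A}
    (hg : Measurable g) : ∫ y, D.maxPosterior (g y).1 (g y).2 ∂ν =
      (∫⁻ y, D.problem.reward (g y).1 (g y).2 ∂ν).toReal := by
  have hm : Measurable fun t : Traj X A => D.problem.reward t.1 t.2 :=
    measurable_traj D.problem.measurable_reward
  simp_rw [← D.toReal_reward]
  exact integral_toReal (hm.comp hg).aemeasurable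
    (ae_of_all _ fun y => (D.problem.reward_le_one _ _).trans_lt ENNReal.one_lt_top)

end Problem

section Bellman

variable (D : M.Domination) (l : ℝ≥0) (n : ℕ) (z : Hist X A n)

theorem policyValue_eq (π : Policy X A) :
    D.policyValue l n z π = D.problem.netPayoff l π n (Measure.dirac z) := by
  rw [policyValue, expRemaining, condLaw, lintegral_length_stoppedLaw,
    D.integral_maxPosterior _ (g := fun o => o) measurable_id]
  rfl

theorem value_eq : D.value l n z = (D.problem.value l n z).toReal := by
  simp only [value, D.policyValue_eq, StoppingProblem.iSup_netPayoff, EReal.toReal_coe,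
    StoppingProblem.meanValue_dirac]

theorem qValue_eq (b : Option A) :
    D.qValue l n z b = (D.problem.actionValue l n z b).toReal - 1 := by
  cases b with
  | none =>
    have hr : (l : ℝ≥0∞) * D.problem.reward n z ≠ ⊤ := ENNReal.mul_ne_top ENNReal.coe_ne_top
      (ne_top_of_le_ne_top ENNReal.one_ne_top (D.problem.reward_le_one n z))
    change _ = ((l : ℝ≥0∞) * D.problem.reward n z + 1).toReal - 1
    rw [ENNReal.toReal_add hr ENNReal.one_ne_top, ENNReal.toReal_mul, ENNReal.toReal_one,
      add_sub_cancel_right, D.toReal_reward]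
    rfl
  | some a =>
    have hm : Measurable fun x => D.problem.value l (n + 1) (z.snoc a x) :=
      (StoppingProblem.measurable_value l (n + 1)).comp (measurable_snoc_right z a)
    simp only [qValue, D.value_eq]
    rw [integral_toReal hm.aemeasurable
      (ae_of_all _ fun x => StoppingProblem.value_ne_top.lt_top), neg_add_eq_sub]
    rfl

theorem iSup_qValue : ⨆ b, D.qValue l n z b = D.value l n z := by
  simp only [D.qValue_eq, D.value_eq, sub_eq_add_neg]
  rw [← ciSup_add (Set.finite_range _).bddAbove, StoppingProblem.iSup_toReal_actionValue,
    add_neg_cancel_right]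

theorem integrable_value (a : A) :
    Integrable (fun x => D.value l (n + 1) (z.snoc a x)) (D.predictive n (z, a)) := by
  have hm : Measurable fun x => (D.problem.value l (n + 1) (z.snoc a x)).toReal :=
    ((StoppingProblem.measurable_value l (n + 1)).comp (measurable_snoc_right z a)).ennreal_toReal
  simp only [D.value_eq]
  refine Integrable.of_bound hm.aestronglyMeasurable (l : ℝ) (ae_of_all _ fun x => ?_)
  rw [Real.norm_of_nonneg ENNReal.toReal_nonneg]
  exact ENNReal.toReal_mono ENNReal.coe_ne_top StoppingProblem.value_le

variable {l}

theorem isGreedy_iff {π : Policy X A} : D.IsGreedy l π ↔ D.problem.IsGreedy l π := by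
  simp only [IsGreedy, StoppingProblem.IsGreedy, D.qValue_eq, sub_le_sub_iff_right,
    ENNReal.toReal_le_toReal StoppingProblem.actionValue_ne_top StoppingProblem.actionValue_ne_top]

theorem exists_isGreedy (l : ℝ≥0) :
    ∃ π : Policy X A, D.IsGreedy l π ∧ ∀ n z, ∃ a, π.prob n z a = 1 := by
  obtain ⟨π, hdet, hπ, -⟩ := D.problem.exists_isGreedy_upperDeriv_le l
  exact ⟨π, D.isGreedy_iff.2 hπ, hdet⟩

end Bellman

section Inference

variable {D : M.Domination} {I : InferenceRule X A 𝓗} (π : Policy X A)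

theorem expMaxPosterior_eq (D : M.Domination) (π : Policy X A) :
    D.expMaxPosterior π = (D.problem.expReward π 0 M.initLaw).toReal := by
  have hm : Measurable fun p : Ω × Traj X A => D.problem.reward p.2.1 p.2.2 :=
    (measurable_traj (f := fun t => D.problem.reward t.1 t.2) D.problem.measurable_reward).comp
      measurable_snd
  rw [expMaxPosterior, D.integral_maxPosterior _ measurable_snd, D.lintegral_pathLaw π hm]
  simp only [lintegral_const, measure_univ, mul_one]
  rfl

theorem correctness_eq (D : M.Domination) (I : InferenceRule X A 𝓗) : M.correctness π I =
    (∫⁻ t, D.posterior t.1 t.2 (M.truth ⁻¹' {I.guess t.1 t.2}) ∂D.trajLaw π).toReal := by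
  have hg : Measurable fun t : Traj X A => I.guess t.1 t.2 := measurable_traj I.measurable_guess
  have hs : MeasurableSet {p : Ω × Traj X A | I.guess p.2.1 p.2.2 = M.truth p.1} :=
    measurableSet_eq_fun (hg.comp measurable_snd) (M.measurable_truth.comp measurable_fst)
  rw [Model.correctness, Measure.real, ← lintegral_indicator_one hs,
    D.lintegral_pathLaw π (measurable_one.indicator hs)]
  exact congrArg _ (lintegral_congr fun t =>
    (lintegral_indicator_one (measurable_prodMk_right hs)).trans
      (congrArg _ (Set.ext fun ω => eq_comm)))

theorem correctness_le (D : M.Domination) (I : InferenceRule X A 𝓗) :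
    M.correctness π I ≤ D.expMaxPosterior π := by
  rw [D.correctness_eq, D.expMaxPosterior_eq]
  exact ENNReal.toReal_mono StoppingProblem.expReward_ne_top
    (lintegral_mono fun t => D.posterior_le_reward t.2 _)

theorem IsMAP.correctness_eq (hI : D.IsMAP I) : M.correctness π I = D.expMaxPosterior π := by
  rw [D.correctness_eq, D.expMaxPosterior_eq]
  refine congrArg _ (lintegral_congr fun t =>
    (D.posterior_le_reward t.2 _).antisymm (iSup_le fun H => ?_))
  exact (ENNReal.toReal_le_toReal (measure_ne_top _ _) (measure_ne_top _ _)).1 (hI t.1 t.2 H)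

theorem exists_isMAP (D : M.Domination) : ∃ I : InferenceRule X A 𝓗, D.IsMAP I := by
  have : Nonempty 𝓗 := (nonempty_of_isProbabilityMeasure M.prior).map M.truth
  have hm (n : ℕ) (H : 𝓗) : Measurable fun z : Hist X A n => D.hypPosterior n z H :=
    (Kernel.measurable_coe _ (M.measurable_truth (measurableSet_singleton H))).ennreal_toReal
  choose f hf hmax using fun n => exists_measurable_selection
    (p := fun z H => ∀ H', D.hypPosterior n z H' ≤ D.hypPosterior n z H)
    (fun z => Finite.exists_max (D.hypPosterior n z))
    fun H => measurableSet_setOfPred.2 (Measurable.forall fun H' =>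
      measurableSet_setOfPred.1 (measurableSet_le (hm n H') (hm n H)))
  exact ⟨⟨f, fun n s _ => hf n s⟩, fun n z H => hmax n z H⟩

end Inference

section Lagrangian

variable {D : M.Domination} {δ : ℝ} {l : ℝ≥0} {π : Policy X A} {I : InferenceRule X A 𝓗}

theorem expTau_eq (D : M.Domination) (π : Policy X A) :
    M.expTau π = 1 + expQueries D.predictive π 0 M.initLaw := by
  have hlength : Measurable fun p : Ω × Traj X A => ((p.2.1 + 1 : ℕ) : ℝ≥0∞) :=
    (measurable_traj (f := fun t : Traj X A => ((t.1 + 1 : ℕ) : ℝ≥0∞)) fun m =>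
      measurable_const (a := ((m + 1 : ℕ) : ℝ≥0∞))).comp measurable_snd
  have hmass : M.pathLaw π Set.univ = D.trajLaw π Set.univ := by
    rw [← lintegral_one, D.lintegral_pathLaw π measurable_const]
    simp only [lintegral_const, measure_univ, mul_one, one_mul]
  have hsum : M.expTau π = D.trajLaw π Set.univ + expQueries D.predictive π 0 M.initLaw := by
    rw [Model.expTau, hmass, D.lintegral_pathLaw π hlength, ← lintegral_length_stoppedLaw,
      ← add_assoc, ← lintegral_one, ← trajLaw, ← lintegral_add_left measurable_const]
    simp only [lintegral_const, measure_univ, mul_one, one_mul, tsub_zero, Nat.cast_add,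
      Nat.cast_one, add_comm]
  rw [hsum]
  by_cases hE : expQueries D.predictive π 0 M.initLaw = ⊤
  · rw [hE, add_top, add_top]
  · exact congrArg (· + _) ((stoppedLaw_univ_le.trans_eq measure_univ).antisymm
      (tsub_eq_zero_iff_le.1 (one_sub_stoppedLaw_univ_eq_zero hE)))

/-- The optimal value of the Lagrangian, as a real number. -/
def dualValue (D : M.Domination) (δ : ℝ) (l : ℝ≥0) : ℝ :=
  D.problem.meanValue l 0 M.initLaw + (l * (δ - 1) - 1)

theorem policyLagrangian_eq_netPayoff_add : D.policyLagrangian δ l π =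
    D.problem.netPayoff l π 0 M.initLaw + ((l * (δ - 1) - 1 : ℝ) : EReal) := by
  rw [policyLagrangian, D.expTau_eq, D.expMaxPosterior_eq, StoppingProblem.netPayoff]
  change _ = -(expQueries D.predictive π 0 M.initLaw : EReal) + _ + _
  by_cases hE : expQueries D.predictive π 0 M.initLaw = ⊤
  · simp [hE]
  rw [neg_coe_add_coe (ENNReal.add_ne_top.2 ⟨ENNReal.one_ne_top, hE⟩), neg_coe_add_coe hE,
    ENNReal.toReal_add ENNReal.one_ne_top hE, ENNReal.toReal_one, ← EReal.coe_add]
  congr 1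
  ring

theorem policyLagrangian_le : D.policyLagrangian δ l π ≤ D.dualValue δ l := by
  rw [policyLagrangian_eq_netPayoff_add, dualValue, EReal.coe_add]
  exact add_le_add_left StoppingProblem.netPayoff_le _

theorem IsGreedy.policyLagrangian_eq (hπ : D.IsGreedy l π) :
    D.policyLagrangian δ l π = D.dualValue δ l := by
  rw [policyLagrangian_eq_netPayoff_add, dualValue, EReal.coe_add,
    (D.isGreedy_iff.1 hπ).netPayoff_eq]

theorem IsGreedy.isOptimalPolicy (hπ : D.IsGreedy l π) : D.IsOptimalPolicy δ l π := fun _ =>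
  policyLagrangian_le.trans_eq hπ.policyLagrangian_eq.symm

theorem lagrangian_le_policyLagrangian : M.lagrangian δ l π I ≤ D.policyLagrangian δ l π := by
  have := correctness_le π D I
  refine add_le_add_right (EReal.coe_le_coe_iff.2 ?_) _
  gcongr

theorem IsMAP.lagrangian_eq (hI : D.IsMAP I) :
    M.lagrangian δ l π I = D.policyLagrangian δ l π := by
  rw [Model.lagrangian, policyLagrangian, hI.correctness_eq]

theorem dual_eq (D : M.Domination) (δ : ℝ) (l : ℝ≥0) : M.dual δ l = D.dualValue δ l := by
  obtain ⟨π, hπ, -⟩ := D.exists_isGreedy l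
  obtain ⟨I, hI⟩ := D.exists_isMAP
  refine le_antisymm (iSup₂_le fun _ _ => lagrangian_le_policyLagrangian.trans policyLagrangian_le)
    ?_
  rw [← hπ.policyLagrangian_eq, ← hI.lagrangian_eq]
  exact le_iSup₂ (f := fun π I => M.lagrangian δ l π I) π I

theorem isDualOptimal_iff (D : M.Domination) :
    M.IsDualOptimal δ l ↔ ∀ l', D.dualValue δ l ≤ D.dualValue δ l' := by
  simp only [← EReal.coe_le_coe_iff, ← D.dual_eq]
  exact ⟨fun h l' => h.2 l' l'.coe_nonneg,
    fun h => ⟨l.coe_nonneg, fun lam' hlam' => h ⟨lam', hlam'⟩⟩⟩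

end Lagrangian

section Dual

variable {D : M.Domination} {δ : ℝ} {l : ℝ≥0}

theorem continuous_dualValue (D : M.Domination) (δ : ℝ) : Continuous (D.dualValue δ) :=
  (D.problem.lipschitzWith_meanValue 0 M.initLaw).continuous.add (by fun_prop)

theorem tendsto_dualValue_atTop
    (h : ∃ π : Policy X A, M.expTau π < ⊤ ∧ 1 - δ < D.expMaxPosterior π) :
    Tendsto (D.dualValue δ) atTop atTop := by
  obtain ⟨π, hτ, hδ⟩ := h
  have hlow (l : ℝ≥0) :
      (l : ℝ) * (D.expMaxPosterior π - 1 + δ) - (M.expTau π).toReal ≤ D.dualValue δ l := by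
    rw [← EReal.coe_le_coe_iff, ← neg_coe_add_coe hτ.ne]
    exact policyLagrangian_le
  refine tendsto_atTop_mono hlow (tendsto_atTop_add_const_right _ _ ?_)
  exact (NNReal.tendsto_coe_atTop.2 tendsto_id).atTop_mul_const (by linarith)

theorem exists_isDualOptimal
    (h : ∃ π : Policy X A, M.expTau π < ⊤ ∧ 1 - δ < D.expMaxPosterior π) :
    ∃ lam, M.IsDualOptimal δ lam := by
  obtain ⟨l, hl⟩ := (D.continuous_dualValue δ).exists_forall_le <|
    cocompact_eq_atTop (α := ℝ≥0) ▸ tendsto_dualValue_atTop h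
  exact ⟨l, D.isDualOptimal_iff.2 hl⟩

theorem exists_isGreedy_le_expMaxPosterior (hl : M.IsDualOptimal δ l) :
    ∃ π, D.IsGreedy l π ∧ 1 - δ ≤ D.expMaxPosterior π := by
  have hslope (h : ℝ≥0) : ∫⁻ z, D.problem.value l 0 z ∂M.initLaw + ENNReal.ofReal (1 - δ) * h ≤
      ∫⁻ z, D.problem.value (l + h) 0 z ∂M.initLaw := by
    rcases le_total (1 - δ) 0 with hδ | hδ
    · rw [ENNReal.ofReal_of_nonpos hδ, zero_mul, add_zero]
      exact lintegral_mono fun z => StoppingProblem.value_mono le_self_add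
    have hmean : D.problem.meanValue l 0 M.initLaw + (1 - δ) * h ≤
        D.problem.meanValue (l + h) 0 M.initLaw := by
      have := D.isDualOptimal_iff.1 hl (l + h)
      rw [dualValue, dualValue, NNReal.coe_add] at this
      linarith
    rw [← ENNReal.ofReal_toReal StoppingProblem.lintegral_value_ne_top, ← ENNReal.ofReal_coe_nnreal,
      ← ENNReal.ofReal_mul hδ,
      ← ENNReal.ofReal_add ENNReal.toReal_nonneg (mul_nonneg hδ h.coe_nonneg)]
    exact ENNReal.ofReal_le_of_le_toReal hmean
  obtain ⟨π, hπ, hle⟩ := StoppingProblem.exists_isGreedy_le_expReward hslope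
  refine ⟨π, D.isGreedy_iff.2 hπ, ?_⟩
  rw [D.expMaxPosterior_eq]
  exact (ENNReal.ofReal_le_iff_le_toReal StoppingProblem.expReward_ne_top).1 hle

end Dual

end Model.Domination

end Application

end PureExploration

theorem theorem3p3_general {Ω X A 𝓗 : Type*}
    [MetricSpace Ω] [CompactSpace Ω] [MeasurableSpace Ω] [BorelSpace Ω]
    [MetricSpace X] [CompactSpace X] [MeasurableSpace X] [BorelSpace X]
    [Fintype A] [TopologicalSpace A] [DiscreteTopology A] [MeasurableSpace A]
    [DiscreteMeasurableSpace A]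
    [Fintype 𝓗] [MeasurableSpace 𝓗] [DiscreteMeasurableSpace 𝓗]
    (M : Model Ω X A 𝓗) (D : M.Domination) (δ : ℝ) :
    (∀ lam : ℝ, 0 ≤ lam →
      (∀ n (z : Hist X A n),
        D.qValue lam n z none = lam * D.maxPosterior n z ∧
        ∀ a : A,
          Integrable (fun x => ⨆ b, D.qValue lam (n + 1) (z.snoc a x) b)
            (D.predictive n (z, a)) ∧
          D.qValue lam n z (some a) =
            -1 + ∫ x, (⨆ b, D.qValue lam (n + 1) (z.snoc a x) b) ∂(D.predictive n (z, a))) ∧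
      (∃ π : Policy X A, D.IsGreedy lam π ∧ ∀ n z, ∃ a, π.prob n z a = 1) ∧
      (∃ I : InferenceRule X A 𝓗, D.IsMAP I) ∧
      (∀ (π : Policy X A) (I : InferenceRule X A 𝓗), D.IsGreedy lam π → D.IsMAP I →
        ∀ (π' : Policy X A) (I' : InferenceRule X A 𝓗),
          M.lagrangian δ lam π' I' ≤ M.lagrangian δ lam π I)) ∧
    ((∃ π : Policy X A, M.expTau π < ⊤ ∧ 1 - δ < D.expMaxPosterior π) →
      ∃ lam, M.IsDualOptimal δ lam) ∧
    (∀ lam, M.IsDualOptimal δ lam → D.UniqueOptimalPolicy δ lam →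
      ∀ (π : Policy X A) (I : InferenceRule X A 𝓗), D.IsGreedy lam π → D.IsMAP I →
        1 - δ ≤ M.correctness π I) := by
  refine ⟨fun lam hlam => ?_, Model.Domination.exists_isDualOptimal,
     fun lam hlam huniq π I hπ hI => ?_⟩
  · lift lam to NNReal using hlam
    simp only [D.iSup_qValue]
    refine ⟨fun n z => ⟨rfl, fun a => ⟨D.integrable_value lam n z a, rfl⟩⟩, D.exists_isGreedy lam,
      D.exists_isMAP, fun π I hπ hI π' I' => ?_⟩
    calc
      M.lagrangian δ lam π' I' ≤ D.policyLagrangian δ lam π' :=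
        Model.Domination.lagrangian_le_policyLagrangian
      _ ≤ D.policyLagrangian δ lam π := hπ.isOptimalPolicy π'
      _ = M.lagrangian δ lam π I := hI.lagrangian_eq.symm
  · lift lam to NNReal using hlam.1
    obtain ⟨π', hπ', hle⟩ := Model.Domination.exists_isGreedy_le_expMaxPosterior hlam
    have hlaw : M.pathLaw π = M.pathLaw π' := huniq π π' hπ.isOptimalPolicy hπ'.isOptimalPolicy
    rwa [hI.correctness_eq, Model.Domination.expMaxPosterior, hlaw]

theorem theorem3p3 {Ω X A 𝓗 : Type*}
    [MetricSpace Ω] [CompactSpace Ω] [MeasurableSpace Ω] [BorelSpace Ω]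
    [MetricSpace X] [CompactSpace X] [MeasurableSpace X] [BorelSpace X]
    [Fintype A] [TopologicalSpace A] [DiscreteTopology A] [MeasurableSpace A]
    [DiscreteMeasurableSpace A]
    [Fintype 𝓗] [MeasurableSpace 𝓗] [DiscreteMeasurableSpace 𝓗]
    (M : Model Ω X A 𝓗) (D : M.Domination) (δ : ℝ) (hδ₀ : 0 < δ) (hδ₁ : δ < 1) :
    -- optimality of greedy policies with maximum a posteriori inference, for every multiplier
    (∀ lam : ℝ, 0 ≤ lam →
      -- the action values satisfy the recursion
      (∀ n (z : Hist X A n),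
        D.qValue lam n z none = lam * D.maxPosterior n z ∧
        ∀ a : A,
          Integrable (fun x => ⨆ b, D.qValue lam (n + 1) (z.snoc a x) b)
            (D.predictive n (z, a)) ∧
          D.qValue lam n z (some a) =
            -1 + ∫ x, (⨆ b, D.qValue lam (n + 1) (z.snoc a x) b) ∂(D.predictive n (z, a))) ∧
      -- deterministic greedy policies and maximum a posteriori rules exist
      (∃ π : Policy X A, D.IsGreedy lam π ∧ ∀ n z, ∃ a, π.prob n z a = 1) ∧
      (∃ I : InferenceRule X A 𝓗, D.IsMAP I) ∧
      -- all such pairs are optimal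
      (∀ (π : Policy X A) (I : InferenceRule X A 𝓗), D.IsGreedy lam π → D.IsMAP I →
        ∀ (π' : Policy X A) (I' : InferenceRule X A 𝓗),
          M.lagrangian δ lam π' I' ≤ M.lagrangian δ lam π I)) ∧
    -- correctness at the optimal multipliers
    (D.Identifiable →
      (∃ lam, M.IsDualOptimal δ lam) ∧
      ∀ lam, M.IsDualOptimal δ lam → D.UniqueOptimalPolicy δ lam →
        ∀ (π : Policy X A) (I : InferenceRule X A 𝓗), D.IsGreedy lam π → D.IsMAP I →
          1 - δ ≤ M.correctness π I) := by
  obtain ⟨hgreedy, hdual, hcorrect⟩ := theorem3p3_general M D δ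
  refine ⟨hgreedy, fun hid => ⟨hdual ?_, hcorrect⟩⟩
  obtain ⟨π, hτ, hπ⟩ := hid (δ / 2) (half_pos hδ₀)
  exact ⟨π, hτ, by linarith⟩
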